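/- Let $P$ be a polynomial with complex coefficients and $P(0)=0$. For real $N>1$ and an integer $n\ge 1$ put $$a_n=\frac{(\mu\star\Lambda\star\Lambda)(n)}{(\log N)^2}\,P\Big(\frac{\log (N/n)}{\log N}\Big),\qquad b_n=\mu(n)\,P\Big(\frac{\log (N/n)}{\log N}\Big)\sum_{\substack{q_1\ne q_2\\ q_1,\,q_2\mid n}}\frac{(\log q_1)(\log q_2)}{(\log N)^2},\qquad c_n=a_n-b_n,$$ where $\star$ is Dirichlet convolution, $\mu$ is the Möbius function, $\Lambda$ is the von Mangoldt function, and the last sum is over ordered pairs of distinct primes dividing $n$. (Here $a_n$ is the unrestricted mollifier coefficient for $K=2$ and $b_n$ is Feng's coefficient, supported on squarefree $n$.) (1) For every $N>1$ and $n \geq 1$, one has $c_n=0$ unless $n=p^k m$ with $p$ prime, $k\ge 2$, and $m$ squarefree and coprime to $p$, in which case $$c_n=\frac{(\log p)^2\mu(m)}{(\log N)^2}\,P\Big(\frac{\log (N/n)}{\log N}\Big).$$ (2) For an integrable $\Phi:\mathbb R\to\mathbb C$ with Fourier transform $\widehat\Phi$, real $T$, a real number $N$, complex $\alpha,\beta$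 and sequences $x,y$, write $$M(x,y)=T\,\widehat\Phi(0)\,\zeta(1+\alpha+\beta)\sum_{1\le d,e\le N}\frac{x_d\,y_e}{[d,e]}\,\frac{(d,e)^{\alpha+\beta}}{d^{\alpha}e^{\beta}},$$ where $[d,e]$ and $(d,e)$ are the least common multiple and the greatest common divisor. There is an integer $A\ge 0$, depending only on $P$, such that for every fixed $\theta\in(0,1)$, every fixed integrable $\Phi$ and all constants $c_0,C_0>0$, with $N=T^{\theta}$, the four quantities $$M(b,c),\qquad M(c,b),\qquad M(c,c),\qquad M(a,a)-M(b,b)$$ are all $$\ll T\,\frac{(\log\log N)^{A}}{(\log N)^2},$$ for all sufficiently large $T$, uniformly for complex $\alpha,\beta$ satisfying $|\alpha|,|\beta|\le C_0/\log T$ and $|\alpha+\beta|\ge c_0/\log T$. The implied constant, and how large $T$ has to be, depend only on $P,\theta,\Phi,c_0,C_0$. Thus the part of the coefficients not supported on squarefree integers contributes negligibly to the main term $M(a,a)$, and only Feng's squarefree coefficients matter. -/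

import Mathlib

/-- The unrestricted Dirichlet convolution `(μ ⋆ Λ ⋆ Λ)(n)`. -/
noncomputable def muLambdaSq (n : ℕ) : ℝ :=
  ((ArithmeticFunction.moebius : ArithmeticFunction ℝ) *
    (ArithmeticFunction.vonMangoldt * ArithmeticFunction.vonMangoldt)) n

/-- The polynomial weight `P(log(N/n)/log N)`. -/
noncomputable def polyWeight (P : Polynomial ℂ) (N : ℝ) (n : ℕ) : ℂ :=
  P.eval ((Real.log (N / n) / Real.log N : ℝ) : ℂ)

/-- The unrestricted mollifier coefficient `a_n` for `K = 2`. -/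
noncomputable def coeffA (P : Polynomial ℂ) (N : ℝ) (n : ℕ) : ℂ :=
  ((muLambdaSq n / Real.log N ^ 2 : ℝ) : ℂ) * polyWeight P N n

/-- `h(n)`: the sum of `(log q₁)(log q₂)/(log N)²` over the ordered pairs of distinct primes
`q₁ ≠ q₂` dividing `n`. -/
noncomputable def primePairSum (N : ℝ) (n : ℕ) : ℝ :=
  ∑ q ∈ n.primeFactors.offDiag, Real.log q.1 * Real.log q.2 / Real.log N ^ 2

/-- Feng's coefficient `b_n`, supported on squarefree `n`. -/
noncomputable def coeffB (P : Polynomial ℂ) (N : ℝ) (n : ℕ) : ℂ :=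
  (ArithmeticFunction.moebius n : ℂ) * polyWeight P N n * ((primePairSum N n : ℝ) : ℂ)

/-- The difference `c_n = a_n - b_n`. -/
noncomputable def coeffC (P : Polynomial ℂ) (N : ℝ) (n : ℕ) : ℂ :=
  coeffA P N n - coeffB P N n

open scoped FourierTransform in
/-- The main term
`T Φ̂(0) ζ(1+α+β) ∑_{d,e ≤ N} (x_d y_e / [d,e]) (d,e)^{α+β} / (d^α e^β)`
attached to two coefficient sequences `x` and `y`. -/
noncomputable def mainTerm (Φ : ℝ → ℂ) (T N : ℝ) (α β : ℂ) (x y : ℕ → ℂ) : ℂ :=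
  (T : ℂ) * 𝓕 Φ 0 * riemannZeta (1 + α + β) *
    ∑ d ∈ Finset.Icc 1 ⌊N⌋₊, ∑ e ∈ Finset.Icc 1 ⌊N⌋₊,
      x d * y e / (Nat.lcm d e : ℂ) *
        ((Nat.gcd d e : ℂ) ^ (α + β) / ((d : ℂ) ^ α * (e : ℂ) ^ β))

/-! Since `μ ⋆ Λ = -μ log` and multiplication by `log` is a derivation for Dirichlet convolution, `μ
⋆ Λ ⋆ Λ = μ log² + (Λ log) ⋆ μ`. At squarefree `n` this is `μ(n)` times the sum over pairs of
distinct primes. In general, what remains after subtracting Feng's coefficient is a sum over the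
primes `q` with `q² ∣ n` of `log² q` times `μ` of the part of `n` prime to `q` (`muLambdaSq_sub`).
Equivalently, `c` is, up to the weight and `(log N)⁻²`, a unitary convolution of `μ` with `Λ²`
restricted to proper prime powers.

For the main terms, `[d,e](d,e) = de`, and Möbius inversion writes `(d,e)^(1+α+β)` as a sum over
common divisors `r`. The double sum becomes a sum over `r` of `jordanCoeff (α+β) r`, of size at most
a constant times `r w(r)`, times two one-variable sums over multiples of `r` (`double_sum_eq`). Here
`w(r)` is the sum of reciprocals of the divisors of `r`, and `L = log N`.

Each one-variable sum reduces to sums of `μ(m) m^(-1-α) Q(log(x/m)/L)` over `m ≤ x` prime to some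
modulus. As `Q(0) = 0`, these are `O(w/L)` (`exists_norm_mollifier_le`). The argument is elementary:
compare `log(x/m)` with harmonic numbers, then pass to general weights by Taylor's formula with
integral remainder. So the sum for `b` is `O(w(r)/(rL))`. The sum for `c` is `w(r)/(rL³)` times a
sum over proper prime powers `j` weighted by `(r,j)/j`, and is also `O(w(r)/(rL))`.

Proper prime powers are sparse, so summing `w(r)³/r` times that weight over `r ≤ N` costs only
`O(L)`. Any double sum involving `c` is therefore `O(L⁻³)`, and `ζ(1+α+β) = O(L)` gives `O(T/L²)`,
with no power of `log log N`. Bilinearity handles `M(a,a) - M(b,b)`. -/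

open ArithmeticFunction

/-! ### Closed form of the difference of the two coefficients -/

/-- Sums over divisors of a function supported on prime powers. -/
theorem sum_divisors_eq_sum_prime_pow {n : ℕ} (hn : n ≠ 0) (F : ℕ → ℝ)
    (hF : ∀ a, ¬ IsPrimePow a → F a = 0) :
    ∑ a ∈ n.divisors, F a
      = ∑ q ∈ n.primeFactors, ∑ k ∈ Finset.Icc 1 (n.factorization q), F (q ^ k) := by
  rw [← Finset.sum_filter_of_ne (p := IsPrimePow) (fun a _ h => by
    by_contra hc; exact h (hF a hc)), Finset.sum_sigma']
  symm
  refine Finset.sum_nbij (fun x => x.1 ^ x.2) ?_ ?_ ?_ (fun _ _ => rfl)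
  · rintro ⟨q, k⟩ h
    simp only [Finset.mem_sigma, Nat.mem_primeFactors, Finset.mem_Icc] at h
    obtain ⟨⟨hq, -, -⟩, hk1, hk2⟩ := h
    simp only [Finset.mem_filter, Nat.mem_divisors]
    exact ⟨⟨(hq.pow_dvd_iff_le_factorization hn).2 hk2, hn⟩, hq.isPrimePow.pow (by omega)⟩
  · rintro ⟨q, k⟩ h ⟨q', k'⟩ h' he
    simp only [Finset.coe_sigma, Set.mem_sigma_iff, Finset.mem_coe, Nat.mem_primeFactors,
      Finset.mem_Icc] at h h'
    simp only at he
    have hqq : q = q' := by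
      have h1 : q ∣ q' ^ k' := he ▸ dvd_pow_self q (by omega)
      exact (Nat.prime_dvd_prime_iff_eq h.1.1 h'.1.1).1 (h.1.1.dvd_of_dvd_pow h1)
    subst hqq
    have := Nat.pow_right_injective h.1.1.two_le he
    subst this
    rfl
  · intro a ha
    simp only [Finset.coe_filter, Nat.mem_divisors, Set.mem_ofPred_eq] at ha
    obtain ⟨⟨hd, -⟩, hp⟩ := ha
    obtain ⟨q, k, hq, hk, rfl⟩ := (isPrimePow_nat_iff _).1 hp
    refine ⟨⟨q, k⟩, ?_, rfl⟩
    simp only [Finset.coe_sigma, Set.mem_sigma_iff, Finset.mem_coe, Nat.mem_primeFactors,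
      Finset.mem_Icc]
    exact ⟨⟨hq, (dvd_pow_self q (by omega)).trans hd, hn⟩, hk,
      (hq.pow_dvd_iff_le_factorization hn).1 hd⟩

/-- Convolving `μ log` with `1` gives `-Λ`; Möbius inversion then yields the formula. -/
theorem moebius_mul_vonMangoldt_apply (n : ℕ) :
    ((moebius : ArithmeticFunction ℝ) * vonMangoldt) n = -((moebius n : ℝ) * Real.log n) := by
  set D : ArithmeticFunction ℝ := ⟨fun n => (moebius n : ℝ) * Real.log n, by simp⟩ with hD
  have h1 : D * (zeta : ArithmeticFunction ℝ) = -vonMangoldt := by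
    ext n
    rw [coe_mul_zeta_apply]
    exact sum_moebius_mul_log_eq
  have h2 : D = -((moebius : ArithmeticFunction ℝ) * vonMangoldt) := by
    calc D = D * ((zeta : ArithmeticFunction ℝ) * (moebius : ArithmeticFunction ℝ)) := by
          rw [coe_zeta_mul_coe_moebius, mul_one]
      _ = _ := by rw [← mul_assoc, h1, mul_comm (moebius : ArithmeticFunction ℝ)]; exact neg_mul _ _
  have h3 := congrArg (fun f : ArithmeticFunction ℝ => f n) h2
  have h4 : (moebius n : ℝ) * Real.log n = -(((moebius : ArithmeticFunction ℝ) * vonMangoldt) n) :=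
    h3
  rw [h4, neg_neg]

/-- The Leibniz rule for `log` applied to `Λ ⋆ μ = -μ log` gives `-μ log² = Λ ⋆ (μ log) + (Λ log) ⋆
μ`, and the first term on the right is `-(μ ⋆ Λ ⋆ Λ)`. -/
theorem muLambdaSq_eq (n : ℕ) :
    muLambdaSq n = (moebius n : ℝ) * Real.log n ^ 2
      + ∑ a ∈ n.divisors, vonMangoldt a * Real.log a * (moebius (n / a) : ℝ) := by
  have e1 : muLambdaSq n
      = -∑ x ∈ n.divisorsAntidiagonal, vonMangoldt x.1 * ((moebius x.2 : ℝ) * Real.log x.2) := by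
    rw [muLambdaSq, ← mul_assoc, mul_comm, mul_apply, ← Finset.sum_neg_distrib]
    refine Finset.sum_congr rfl fun x _ => ?_
    rw [moebius_mul_vonMangoldt_apply]; ring
  have e2 : -((moebius n : ℝ) * Real.log n) * Real.log n
      = ∑ x ∈ n.divisorsAntidiagonal, vonMangoldt x.1 * ((moebius x.2 : ℝ) * Real.log x.2)
        + ∑ x ∈ n.divisorsAntidiagonal, vonMangoldt x.1 * Real.log x.1 * (moebius x.2 : ℝ) := by
    rw [← moebius_mul_vonMangoldt_apply, mul_comm (moebius : ArithmeticFunction ℝ), mul_apply,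
      Finset.sum_mul, ← Finset.sum_add_distrib]
    refine Finset.sum_congr rfl fun x hx => ?_
    obtain ⟨hx1, hx2⟩ := Nat.mem_divisorsAntidiagonal.1 hx
    have h1 : (x.1 : ℝ) ≠ 0 := by
      rintro h; apply hx2; rw [← hx1, Nat.cast_eq_zero.1 h, zero_mul]
    have h2 : (x.2 : ℝ) ≠ 0 := by
      rintro h; apply hx2; rw [← hx1, Nat.cast_eq_zero.1 h, mul_zero]
    rw [← hx1, Nat.cast_mul, Real.log_mul h1 h2, intCoe_apply]
    ring
  rw [Nat.sum_divisorsAntidiagonal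
    (f := fun a b => vonMangoldt a * Real.log a * (moebius b : ℝ))] at e2
  linarith

theorem moebius_prime_pow_mul_of_two_le {q k m : ℕ} (hq : q.Prime) (hk : 2 ≤ k) :
    moebius (q ^ k * m) = 0 := by
  apply moebius_eq_zero_of_not_squarefree
  intro h
  have : q * q ∣ q ^ k * m := by
    rw [← sq]; exact (pow_dvd_pow q hk).mul_right m
  exact hq.one_lt.ne' (Nat.isUnit_iff.1 (h q this))

/-- The `k`-th term is `k log² q · μ(q^(v-k) m)`, so only `k = v` and `k = v - 1` survive. For `v ≥
2` they contribute `v - (v - 1) = 1` copy of `log² q · μ(m)`, and `μ(q^v m) = 0`. For `v = 1` the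
single term cancels against the added one. -/
theorem sum_prime_pow_log_mul_moebius {q v m : ℕ} (hq : q.Prime) (hv : 1 ≤ v)
    (hm : Nat.Coprime q m) :
    ∑ k ∈ Finset.Icc 1 v, vonMangoldt (q ^ k) * Real.log (q ^ k : ℕ)
        * (moebius (q ^ v * m / q ^ k) : ℝ) + Real.log q ^ 2 * (moebius (q ^ v * m) : ℝ)
      = if 2 ≤ v then Real.log q ^ 2 * (moebius m : ℝ) else 0 := by
  have key : ∀ k ∈ Finset.Icc 1 v, vonMangoldt (q ^ k) * Real.log (q ^ k : ℕ)
        * (moebius (q ^ v * m / q ^ k) : ℝ)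
        = k * Real.log q ^ 2 * (moebius (q ^ (v - k) * m) : ℝ) := by
    intro k hk
    rw [Finset.mem_Icc] at hk
    have h1 : q ^ v * m / q ^ k = q ^ (v - k) * m := by
      apply Nat.div_eq_of_eq_mul_right (pow_pos hq.pos k)
      rw [← mul_assoc, ← pow_add]; congr 2; omega
    rw [h1, vonMangoldt_apply_pow (by omega), vonMangoldt_apply_prime hq, Nat.cast_pow,
      Real.log_pow]
    ring
  rw [Finset.sum_congr rfl key]
  have hqm : moebius (q * m) = -moebius m := by
    rw [isMultiplicative_moebius.map_mul_of_coprime hm, moebius_apply_prime hq]; ring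
  obtain rfl | ⟨u, rfl⟩ : v = 1 ∨ ∃ u, v = u + 2 := by
    rcases Nat.lt_or_ge v 2 with h | h
    · left; omega
    · right; exact ⟨v - 2, by omega⟩
  · simp [hqm]
  · rw [if_pos (by omega), Finset.sum_Icc_succ_top (by omega), Finset.sum_Icc_succ_top (by omega),
      moebius_prime_pow_mul_of_two_le hq (by omega : 2 ≤ u + 2), Finset.sum_eq_zero]
    · have h1 : u + 2 - (u + 1) = 1 := by omega
      rw [h1]
      simp [hqm]
      ring
    · intro k hk
      rw [Finset.mem_Icc] at hk
      rw [moebius_prime_pow_mul_of_two_le hq (by omega)]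
      simp

/-- The arithmetic part of `coeffC`. -/
noncomputable def nonsquarefreePart (n : ℕ) : ℝ :=
  ∑ q ∈ n.primeFactors, if 2 ≤ n.factorization q then
    Real.log q ^ 2 * (moebius (n / q ^ n.factorization q) : ℝ) else 0

/-- For squarefree `n`, `log n` is the sum of `log q` over its primes; squaring and removing the
diagonal gives the claim. Otherwise both sides vanish. -/
theorem moebius_mul_sum_offDiag (n : ℕ) :
    (moebius n : ℝ) * ∑ q ∈ n.primeFactors.offDiag, Real.log q.1 * Real.log q.2
      = (moebius n : ℝ) * (Real.log n ^ 2 - ∑ q ∈ n.primeFactors, Real.log q ^ 2) := by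
  by_cases hs : Squarefree n
  · congr 1
    have hl : Real.log n = ∑ q ∈ n.primeFactors, Real.log q := by
      conv_lhs => rw [← Nat.prod_primeFactors_of_squarefree hs]
      rw [Nat.cast_prod, Real.log_prod]
      intro q hq
      exact Nat.cast_ne_zero.2 (Nat.prime_of_mem_primeFactors hq).ne_zero
    rw [hl, sq (∑ q ∈ n.primeFactors, Real.log q), Finset.sum_mul_sum, ← Finset.sum_product',
      ← Finset.diag_union_offDiag, Finset.sum_union (Finset.disjoint_diag_offDiag _)]
    have hd : ∑ x ∈ n.primeFactors.diag, Real.log x.1 * Real.log x.2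
        = ∑ q ∈ n.primeFactors, Real.log q ^ 2 := by
      rw [Finset.sum_diag]
      exact Finset.sum_congr rfl fun q _ => (sq _).symm
    rw [hd]; ring
  · rw [moebius_eq_zero_of_not_squarefree hs]; simp

theorem muLambdaSq_sub (n : ℕ) :
    muLambdaSq n - (moebius n : ℝ) * ∑ q ∈ n.primeFactors.offDiag, Real.log q.1 * Real.log q.2
      = nonsquarefreePart n := by
  rcases eq_or_ne n 0 with rfl | hn
  · simp [muLambdaSq, nonsquarefreePart]
  rw [moebius_mul_sum_offDiag, muLambdaSq_eq, sum_divisors_eq_sum_prime_pow hn]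
  · have : ∀ x : ℝ, (moebius n : ℝ) * Real.log n ^ 2 + x
        - (moebius n : ℝ) * (Real.log n ^ 2 - ∑ q ∈ n.primeFactors, Real.log q ^ 2)
        = x + ∑ q ∈ n.primeFactors, Real.log q ^ 2 * (moebius n : ℝ) := by
      intro x; rw [← Finset.sum_mul]; ring
    rw [this, ← Finset.sum_add_distrib, nonsquarefreePart]
    refine Finset.sum_congr rfl fun q hq => ?_
    have hq' := Nat.prime_of_mem_primeFactors hq
    have hv : 1 ≤ n.factorization q :=
      (hq'.dvd_iff_one_le_factorization hn).1 (Nat.dvd_of_mem_primeFactors hq)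
    have h := sum_prime_pow_log_mul_moebius hq' hv (Nat.coprime_ordCompl hq' hn)
    rw [Nat.ordProj_mul_ordCompl_eq_self] at h
    exact h
  · intro a ha
    rw [vonMangoldt_eq_zero_iff.2 ha]; simp

theorem coeffC_eq (P : Polynomial ℂ) (N : ℝ) (n : ℕ) :
    coeffC P N n = ((nonsquarefreePart n / Real.log N ^ 2 : ℝ) : ℂ) * polyWeight P N n := by
  rw [coeffC, coeffA, coeffB, primePairSum, ← muLambdaSq_sub, ← Finset.sum_div]
  push_cast
  ring

theorem nonsquarefreePart_prime_pow_mul {p k m : ℕ} (hp : p.Prime) (hk : 2 ≤ k)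
    (hm : Squarefree m) (hc : Nat.Coprime m p) :
    nonsquarefreePart (p ^ k * m) = Real.log p ^ 2 * (moebius m : ℝ) := by
  have hm0 := hm.ne_zero
  have hn : p ^ k * m ≠ 0 := mul_ne_zero (pow_ne_zero _ hp.ne_zero) hm0
  have hf : ∀ q, (p ^ k * m).factorization q = (if q = p then k else 0) + m.factorization q := by
    intro q
    rw [Nat.factorization_mul (pow_ne_zero _ hp.ne_zero) hm0, hp.factorization_pow]
    simp [Finsupp.single_apply, eq_comm]
  have hmp : m.factorization p = 0 :=
    Nat.factorization_eq_zero_of_not_dvd fun h =>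
      hp.one_lt.ne' (Nat.eq_one_of_dvd_coprimes hc h dvd_rfl)
  rw [nonsquarefreePart, Finset.sum_eq_single p]
  · rw [hf, hmp, if_pos rfl, add_zero, if_pos hk, Nat.mul_div_cancel_left _ (pow_pos hp.pos k)]
  · intro q hq hqp
    rw [hf, if_neg hqp, zero_add, if_neg]
    have := hm.natFactorization_le_one q
    omega
  · intro h
    exact absurd (Nat.mem_primeFactors.2 ⟨hp, (dvd_pow_self p (by omega)).mul_right m, hn⟩) h

theorem nonsquarefreePart_eq_zero {n : ℕ}
    (h : ¬ ∃ p k m : ℕ, p.Prime ∧ 2 ≤ k ∧ Squarefree m ∧ Nat.Coprime m p ∧ n = p ^ k * m) :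
    nonsquarefreePart n = 0 := by
  refine Finset.sum_eq_zero fun q hq => ?_
  split_ifs with hv
  · have hq' := Nat.prime_of_mem_primeFactors hq
    by_cases hs : Squarefree (n / q ^ n.factorization q)
    · exact absurd ⟨q, _, _, hq', hv, hs,
        (Nat.coprime_ordCompl hq' (Nat.mem_primeFactors.1 hq).2.2).symm,
        (Nat.ordProj_mul_ordCompl_eq_self n q).symm⟩ h
    · rw [moebius_eq_zero_of_not_squarefree hs]; simp
  · rfl

/-- The square of the von Mangoldt function, restricted to proper prime powers. -/
noncomputable def properLambdaSq (j : ℕ) : ℝ := if j.Prime then 0 else vonMangoldt j ^ 2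

/-- Among the powers of `q` dividing `n`, only the full one is coprime to its cofactor, and
`properLambdaSq` discards it when the exponent is 1. In this form `n = j m` can be summed over `j`
and `m` separately. -/
theorem nonsquarefreePart_eq_sum {n : ℕ} (hn : n ≠ 0) :
    nonsquarefreePart n = ∑ j ∈ n.divisors,
      if Nat.Coprime j (n / j) then properLambdaSq j * (moebius (n / j) : ℝ) else 0 := by
  rw [sum_divisors_eq_sum_prime_pow hn, nonsquarefreePart]
  · refine Finset.sum_congr rfl fun q hq => ?_
    have hq' := Nat.prime_of_mem_primeFactors hq
    have hv : 1 ≤ n.factorization q :=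
      (hq'.dvd_iff_one_le_factorization hn).1 (Nat.dvd_of_mem_primeFactors hq)
    rw [Finset.sum_eq_single (n.factorization q)]
    · rw [if_pos ((Nat.coprime_ordCompl hq' hn).pow_left _), properLambdaSq]
      split_ifs with h1 h2 h2
      · exact absurd h2 (Nat.Prime.not_prime_pow h1)
      · rw [vonMangoldt_apply_pow (by omega), vonMangoldt_apply_prime hq']
      · simp
      · have : n.factorization q = 1 := by omega
        rw [this, pow_one] at h2
        exact absurd hq' h2
    · intro k hk hkv
      rw [Finset.mem_Icc] at hk
      rw [if_neg]
      intro hc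
      have h1 : q ∣ n / q ^ k := by
        rw [Nat.dvd_div_iff_mul_dvd ((hq'.pow_dvd_iff_le_factorization hn).2 hk.2), ← pow_succ]
        exact (hq'.pow_dvd_iff_le_factorization hn).2 (by omega)
      exact hq'.one_lt.ne' (Nat.eq_one_of_dvd_coprimes hc (dvd_pow_self q (by omega)) h1)
    · intro h; exact absurd (Finset.mem_Icc.2 ⟨hv, le_rfl⟩) h
  · intro a ha
    have : properLambdaSq a = 0 := by
      rw [properLambdaSq, vonMangoldt_eq_zero_iff.2 ha]; simp
    rw [this]; simp

/-! ### Rearrangement of divisor sums -/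

theorem sum_Icc_filter_dvd {M : Type*} [AddCommMonoid M] (n s : ℕ) (hs : 1 ≤ s) (F : ℕ → M) :
    ∑ d ∈ Finset.Icc 1 n with s ∣ d, F d = ∑ m ∈ Finset.Icc 1 (n / s), F (s * m) := by
  symm
  refine Finset.sum_nbij (fun m => s * m) ?_ ?_ ?_ (fun _ _ => rfl)
  · intro m hm
    rw [Finset.mem_Icc] at hm
    rw [Finset.mem_filter, Finset.mem_Icc]
    exact ⟨⟨Nat.mul_pos hs hm.1, mul_comm m s ▸ (Nat.le_div_iff_mul_le hs).1 hm.2⟩,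
      dvd_mul_right _ _⟩
  · intro a _ b _ h
    exact Nat.eq_of_mul_eq_mul_left hs h
  · intro d hd
    rw [Finset.mem_coe, Finset.mem_filter, Finset.mem_Icc] at hd
    obtain ⟨⟨h1, h2⟩, m, rfl⟩ := hd
    refine ⟨m, ?_, rfl⟩
    rw [Finset.mem_coe, Finset.mem_Icc]
    exact ⟨Nat.pos_of_mul_pos_left h1, (Nat.le_div_iff_mul_le hs).2 (mul_comm m s ▸ h2)⟩

theorem sum_Icc_sum_divisors {M : Type*} [AddCommMonoid M] (n : ℕ) (F : ℕ → ℕ → M) :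
    ∑ k ∈ Finset.Icc 1 n, ∑ d ∈ k.divisors, F d k
      = ∑ d ∈ Finset.Icc 1 n, ∑ k ∈ Finset.Icc 1 n with d ∣ k, F d k := by
  refine Finset.sum_comm' fun k d => ?_
  simp only [Finset.mem_Icc, Nat.mem_divisors, Finset.mem_filter]
  constructor
  · rintro ⟨⟨h1, h2⟩, h3, -⟩
    exact ⟨⟨⟨h1, h2⟩, h3⟩, Nat.pos_of_dvd_of_pos h3 h1, (Nat.le_of_dvd h1 h3).trans h2⟩
  · rintro ⟨⟨⟨h1, h2⟩, h3⟩, -⟩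
    exact ⟨⟨h1, h2⟩, h3, by omega⟩

theorem sum_Icc_sum_divisors' {M : Type*} [AddCommMonoid M] (n : ℕ) (F : ℕ → ℕ → M) :
    ∑ k ∈ Finset.Icc 1 n, ∑ d ∈ k.divisors, F d k
      = ∑ d ∈ Finset.Icc 1 n, ∑ m ∈ Finset.Icc 1 (n / d), F d (d * m) := by
  rw [sum_Icc_sum_divisors]
  refine Finset.sum_congr rfl fun d hd => ?_
  rw [sum_Icc_filter_dvd n d (Finset.mem_Icc.1 hd).1]

/-! ### The Möbius function restricted to integers coprime to `r` -/

/-- The Möbius function restricted to the integers coprime to `r`. -/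
noncomputable def coprimeMoebius (r m : ℕ) : ℝ := if Nat.Coprime m r then (moebius m : ℝ) else 0

theorem abs_coprimeMoebius_le_one (r m : ℕ) : |coprimeMoebius r m| ≤ 1 := by
  rw [coprimeMoebius]
  split_ifs
  · exact_mod_cast abs_moebius_le_one
  · simp

/-- Only squarefree divisors prime to `r` contribute. These are the divisors of `k'`, the product of
the primes of `k` not dividing `r`, so the sum is that of `μ` over all divisors of `k'`. -/
theorem sum_divisors_coprimeMoebius (r : ℕ) {k : ℕ} (hk : k ≠ 0) :
    ∑ d ∈ k.divisors, coprimeMoebius r d = if ∀ p ∈ k.primeFactors, p ∣ r then 1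
      else 0 := by
  set s := k.primeFactors.filter (fun p => ¬ p ∣ r) with hs
  set k' := ∏ p ∈ s, p with hk'
  have hsp : ∀ p ∈ s, p.Prime := fun p hp =>
    Nat.prime_of_mem_primeFactors (Finset.mem_filter.1 hp).1
  have hk'0 : k' ≠ 0 := Finset.prod_ne_zero_iff.2 fun p hp => (hsp p hp).ne_zero
  have hk'd : k' ∣ k := (Finset.prod_dvd_prod_of_subset _ _ _ (Finset.filter_subset _ _)).trans
    (Nat.prod_primeFactors_dvd k)
  have hk'c : Nat.Coprime k' r := Nat.Coprime.prod_left fun p hp =>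
    (Nat.Prime.coprime_iff_not_dvd (hsp p hp)).2 (Finset.mem_filter.1 hp).2
  have h1 : ∑ d ∈ k.divisors, coprimeMoebius r d = ∑ d ∈ k'.divisors, (moebius d : ℝ) := by
    symm
    rw [← Finset.sum_subset (Nat.divisors_subset_of_dvd hk hk'd)]
    · refine Finset.sum_congr rfl fun d hd => ?_
      rw [coprimeMoebius, if_pos (hk'c.coprime_dvd_left (Nat.dvd_of_mem_divisors hd))]
    · intro d hd hd'
      rw [coprimeMoebius]
      split_ifs with hc
      · by_cases hsq : Squarefree d
        · exfalso
          apply hd'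
          rw [Nat.mem_divisors]
          refine ⟨?_, hk'0⟩
          rw [← Nat.prod_primeFactors_of_squarefree hsq]
          refine Finset.prod_dvd_prod_of_subset _ _ _ fun p hp => ?_
          have hpp := Nat.prime_of_mem_primeFactors hp
          have hpd := Nat.dvd_of_mem_primeFactors hp
          rw [hs, Finset.mem_filter]
          refine ⟨Nat.mem_primeFactors.2 ⟨hpp, hpd.trans (Nat.dvd_of_mem_divisors hd), hk⟩,
            fun h => hpp.one_lt.ne' (Nat.eq_one_of_dvd_coprimes hc hpd h)⟩
        · rw [moebius_eq_zero_of_not_squarefree hsq]; simp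
      · rfl
  have h2 : ∑ d ∈ k'.divisors, moebius d = if k' = 1 then 1 else 0 := by
    rw [← coe_mul_zeta_apply, moebius_mul_coe_zeta, one_apply]
  have h3 : k' = 1 ↔ ∀ p ∈ k.primeFactors, p ∣ r := by
    rw [hk', Finset.prod_eq_one_iff]
    constructor
    · intro h p hp
      by_contra hpr
      have hps : p ∈ s := Finset.mem_filter.2 ⟨hp, hpr⟩
      exact (hsp p hps).one_lt.ne' (h p hps)
    · intro h p hp
      exact absurd (h p (Finset.mem_filter.1 hp).1) (Finset.mem_filter.1 hp).2
  rw [h1, ← Int.cast_sum, h2]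
  simp only [h3]
  split_ifs <;> simp

theorem sum_Icc_coprimeMoebius_mul (r n : ℕ) (F : ℕ → ℝ) :
    ∑ m ∈ Finset.Icc 1 n, ∑ l ∈ Finset.Icc 1 (n / m), coprimeMoebius r m * F (m * l)
      = ∑ k ∈ Finset.Icc 1 n with ∀ p ∈ k.primeFactors, p ∣ r, F k := by
  rw [← sum_Icc_sum_divisors' n (fun m k => coprimeMoebius r m * F k), Finset.sum_filter]
  refine Finset.sum_congr rfl fun k hk => ?_
  rw [Finset.mem_Icc] at hk
  rw [← Finset.sum_mul, sum_divisors_coprimeMoebius r (by omega)]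
  split_ifs <;> simp

/-- The sum of the reciprocals of the divisors of `r`. -/
noncomputable def invDivisorSum (r : ℕ) : ℝ := ∑ d ∈ r.divisors, (d : ℝ)⁻¹

theorem one_le_invDivisorSum {r : ℕ} (hr : r ≠ 0) : 1 ≤ invDivisorSum r := by
  have h : ((1 : ℕ) : ℝ)⁻¹ ≤ ∑ d ∈ r.divisors, (d : ℝ)⁻¹ :=
    Finset.single_le_sum (f := fun d : ℕ => (d : ℝ)⁻¹) (fun _ _ => by positivity)
      (Nat.one_mem_divisors.2 hr)
  simpa [invDivisorSum] using h

theorem invDivisorSum_nonneg (r : ℕ) : 0 ≤ invDivisorSum r :=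
  Finset.sum_nonneg fun _ _ => by positivity

/-- A covering bound for nonnegative terms: `φ` need not be injective, so parametrisations need no
uniqueness. -/
theorem sum_le_sum_comp_of_subset_image {ι κ : Type*} [DecidableEq ι] {s : Finset ι} {t : Finset κ}
    (φ : κ → ι) (h : s ⊆ t.image φ) (f : ι → ℝ) (hf : ∀ i, 0 ≤ f i) :
    ∑ i ∈ s, f i ≤ ∑ x ∈ t, f (φ x) := by
  refine (Finset.sum_le_sum_of_subset_of_nonneg h fun i _ _ => hf i).trans ?_
  rw [← Finset.sum_fiberwise_of_maps_to (s := t) (t := t.image φ) (g := φ)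
    (fun x hx => Finset.mem_image_of_mem φ hx)]
  refine Finset.sum_le_sum fun i hi => ?_
  obtain ⟨x, hx, rfl⟩ := Finset.mem_image.1 hi
  exact Finset.single_le_sum (f := fun y => f (φ y)) (fun _ _ => hf _)
    (Finset.mem_filter.2 ⟨hx, rfl⟩)

theorem sum_Icc_inv_sq_le (n : ℕ) : ∑ b ∈ Finset.Icc 1 n, ((b : ℝ) ^ 2)⁻¹ ≤ 2 := by
  have h := sum_Ioo_inv_sq_le (α := ℝ) 0 (n + 1)
  have e : Finset.Ioo 0 (n + 1) = Finset.Icc 1 n := by ext; simp; omega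
  rw [e] at h
  simpa using h

/-- Write `k = b² a` with `a` squarefree. The primes of `a` divide `r`, hence `a ∣ r`, and the sum
over `b` of `b⁻²` is at most 2. -/
theorem sum_smooth_inv_le {r : ℕ} (hr : r ≠ 0) (n : ℕ) :
    ∑ k ∈ Finset.Icc 1 n with ∀ p ∈ k.primeFactors, p ∣ r, (k : ℝ)⁻¹ ≤ 2 * invDivisorSum r := by
  have h : (Finset.Icc 1 n).filter (fun k => ∀ p ∈ k.primeFactors, p ∣ r)
      ⊆ (r.divisors ×ˢ Finset.Icc 1 n).image (fun x => x.2 ^ 2 * x.1) := by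
    intro k hk
    rw [Finset.mem_filter, Finset.mem_Icc] at hk
    obtain ⟨⟨h1, h2⟩, h3⟩ := hk
    obtain ⟨a, b, rfl, hsq⟩ := Nat.sq_mul_squarefree k
    have hb : b ≠ 0 := by rintro rfl; simp at h1
    refine Finset.mem_image.2 ⟨(a, b), ?_, rfl⟩
    rw [Finset.mem_product, Nat.mem_divisors, Finset.mem_Icc]
    refine ⟨⟨?_, hr⟩, by omega, ?_⟩
    · rw [← Nat.prod_primeFactors_of_squarefree hsq]
      refine Finset.prod_primes_dvd _ (fun p hp => (Nat.prime_of_mem_primeFactors hp).prime) ?_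
      intro p hp
      refine h3 p (Nat.mem_primeFactors.2 ⟨Nat.prime_of_mem_primeFactors hp,
        (Nat.dvd_of_mem_primeFactors hp).mul_left _, by omega⟩)
    · have ha := Nat.pos_of_ne_zero hsq.ne_zero
      calc b ≤ b ^ 2 := Nat.le_self_pow (by norm_num) b
        _ ≤ b ^ 2 * a := Nat.le_mul_of_pos_right _ ha
        _ ≤ n := h2
  refine (sum_le_sum_comp_of_subset_image _ h (fun k : ℕ => (k : ℝ)⁻¹)
    fun _ => by positivity).trans ?_
  rw [Finset.sum_product, invDivisorSum, mul_comm, Finset.sum_mul]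
  refine Finset.sum_le_sum fun a _ => ?_
  have : ∀ b : ℕ, ((b ^ 2 * a : ℕ) : ℝ)⁻¹ = (a : ℝ)⁻¹ * ((b : ℝ) ^ 2)⁻¹ := by
    intro b; push_cast; rw [mul_inv, mul_comm]
  simp only [this]
  rw [← Finset.mul_sum]
  exact mul_le_mul_of_nonneg_left (sum_Icc_inv_sq_le n) (by positivity)

/-- With `⌊n/m⌋` in place of `n/m`, the sum counts the `k ≤ n` all of whose primes divide `r`, hence
is at most `n`; removing the floors costs at most another `n`. -/
theorem abs_sum_coprimeMoebius_div_le (r n : ℕ) :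
    |∑ m ∈ Finset.Icc 1 n, coprimeMoebius r m / m| ≤ 2 := by
  rcases Nat.eq_zero_or_pos n with rfl | hn
  · simp
  have hn' : (0 : ℝ) < n := by exact_mod_cast hn
  have h1 : ∑ m ∈ Finset.Icc 1 n, coprimeMoebius r m * ((n / m : ℕ) : ℝ)
      = ∑ k ∈ Finset.Icc 1 n with ∀ p ∈ k.primeFactors, p ∣ r, (1 : ℝ) := by
    rw [← sum_Icc_coprimeMoebius_mul]
    refine Finset.sum_congr rfl fun m _ => ?_
    simp [mul_comm]
  have h2 : |∑ m ∈ Finset.Icc 1 n, coprimeMoebius r m * ((n / m : ℕ) : ℝ)| ≤ n := by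
    rw [h1, Finset.sum_const, nsmul_eq_mul, mul_one, abs_of_nonneg (by positivity)]
    have := Finset.card_filter_le (Finset.Icc 1 n) (fun k => ∀ p ∈ k.primeFactors, p ∣ r)
    rw [Nat.card_Icc] at this
    exact_mod_cast this
  have h3 : |∑ m ∈ Finset.Icc 1 n, coprimeMoebius r m * ((n : ℝ) / m - (n / m : ℕ))| ≤ n := by
    refine (Finset.abs_sum_le_sum_abs _ _).trans ?_
    calc _ ≤ ∑ m ∈ Finset.Icc 1 n, (1 : ℝ) := by
          refine Finset.sum_le_sum fun m hm => ?_
          rw [abs_mul]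
          refine mul_le_one₀ (abs_coprimeMoebius_le_one r m) (abs_nonneg _) ?_
          rw [← Nat.floor_div_eq_div (K := ℝ) n m, abs_le]
          have h4 := Nat.floor_le (show 0 ≤ (n : ℝ) / m by positivity)
          have h5 := Nat.lt_floor_add_one ((n : ℝ) / m)
          constructor <;> linarith
      _ = n := by simp
  have h4 : (n : ℝ) * ∑ m ∈ Finset.Icc 1 n, coprimeMoebius r m / m
      = ∑ m ∈ Finset.Icc 1 n, coprimeMoebius r m * ((n / m : ℕ) : ℝ)
        + ∑ m ∈ Finset.Icc 1 n, coprimeMoebius r m * ((n : ℝ) / m - (n / m : ℕ)) := by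
    rw [Finset.mul_sum, ← Finset.sum_add_distrib]
    exact Finset.sum_congr rfl fun m _ => by ring
  have h5 : n * |∑ m ∈ Finset.Icc 1 n, coprimeMoebius r m / m| ≤ n * 2 := by
    rw [← abs_of_pos hn', ← abs_mul, abs_of_pos hn', h4]
    exact (abs_add_le _ _).trans (by linarith)
  exact le_of_mul_le_mul_left h5 hn'

theorem abs_harmonic_floor_sub_le {z : ℝ} (hz : 1 ≤ z) :
    |(harmonic ⌊z⌋₊ : ℝ) - Real.log z - Real.eulerMascheroniConstant| ≤ 2 / z := by
  set n := ⌊z⌋₊ with hn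
  have hn1 : 1 ≤ n := Nat.one_le_floor_iff z |>.2 hz
  have hn' : (1 : ℝ) ≤ n := by exact_mod_cast hn1
  have h1 : (n : ℝ) ≤ z := Nat.floor_le (by linarith)
  have h2 : z < n + 1 := Nat.lt_floor_add_one z
  have h3 := Real.eulerMascheroniSeq_lt_eulerMascheroniConstant n
  have h4 := Real.eulerMascheroniConstant_lt_eulerMascheroniSeq' n
  rw [Real.eulerMascheroniSeq] at h3
  rw [Real.eulerMascheroniSeq', if_neg (by omega)] at h4
  have h5 : Real.log n ≤ Real.log z := Real.log_le_log (by linarith) h1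
  have h6 : Real.log z ≤ Real.log (n + 1) := Real.log_le_log (by linarith) h2.le
  have h7 : Real.log (n + 1) - Real.log n ≤ 1 / n := by
    rw [← Real.log_div (by positivity) (by positivity)]
    have := Real.log_le_sub_one_of_pos (show (0 : ℝ) < (n + 1) / n by positivity)
    have e : ((n : ℝ) + 1) / n - 1 = 1 / n := by field_simp; ring
    linarith
  -- From `z < n + 1 ≤ 2n`.
  have h8 : 1 / (n : ℝ) ≤ 2 / z := by
    rw [div_le_div_iff₀ (by linarith) (by linarith)]; linarith
  rw [abs_le]
  constructor <;> linarith

/-- Uniform bound for the logarithmically weighted sum of the Möbius function over integers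
coprime to `r`. -/
theorem abs_sum_coprimeMoebius_log_le {r : ℕ} (hr : r ≠ 0) (y : ℝ) :
    |∑ m ∈ Finset.Icc 1 ⌊y⌋₊, coprimeMoebius r m / m * Real.log (y / m)|
      ≤ 6 * invDivisorSum r := by
  rcases lt_or_ge y 1 with hy | hy
  · have : ⌊y⌋₊ = 0 := Nat.floor_eq_zero.2 hy
    rw [this]
    have := invDivisorSum_nonneg r
    simpa using this
  set n := ⌊y⌋₊ with hn
  have hny : (n : ℝ) ≤ y := Nat.floor_le (by linarith)
  -- With harmonic numbers instead of logarithms the sum is evaluated exactly, by collecting terms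
  -- with the same product `k = m l`.
  have h1 : ∑ m ∈ Finset.Icc 1 n, coprimeMoebius r m / m * (harmonic (n / m) : ℝ)
      = ∑ k ∈ Finset.Icc 1 n with ∀ p ∈ k.primeFactors, p ∣ r, (k : ℝ)⁻¹ := by
    rw [← sum_Icc_coprimeMoebius_mul r n (fun k => (k : ℝ)⁻¹)]
    refine Finset.sum_congr rfl fun m _ => ?_
    rw [harmonic_eq_sum_Icc]
    push_cast
    rw [Finset.mul_sum]
    refine Finset.sum_congr rfl fun l _ => ?_
    rw [mul_inv]; ring
  have h2 : |∑ m ∈ Finset.Icc 1 n, coprimeMoebius r m / m * (harmonic (n / m) : ℝ)|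
      ≤ 2 * invDivisorSum r := by
    rw [h1, abs_of_nonneg (Finset.sum_nonneg fun _ _ => by positivity)]
    exact sum_smooth_inv_le hr n
  have h3 : |Real.eulerMascheroniConstant * ∑ m ∈ Finset.Icc 1 n, coprimeMoebius r m / m| ≤ 2 := by
    rw [abs_mul]
    have a1 := abs_sum_coprimeMoebius_div_le r n
    have a2 : |Real.eulerMascheroniConstant| ≤ 1 := by
      rw [abs_of_pos (by linarith [Real.one_half_lt_eulerMascheroniConstant])]
      linarith [Real.eulerMascheroniConstant_lt_two_thirds]
    have := mul_le_mul a2 a1 (abs_nonneg _) zero_le_one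
    linarith
  -- Each of the `n ≤ y` terms is at most `(1/m) · (2m/y) = 2/y`.
  have h4 : |∑ m ∈ Finset.Icc 1 n, coprimeMoebius r m / m * ((harmonic (n / m) : ℝ)
      - Real.log (y / m) - Real.eulerMascheroniConstant)| ≤ 2 := by
    refine (Finset.abs_sum_le_sum_abs _ _).trans ?_
    calc _ ≤ ∑ m ∈ Finset.Icc 1 n, 2 / y := by
          refine Finset.sum_le_sum fun m hm => ?_
          rw [Finset.mem_Icc] at hm
          have hm1 : (1 : ℝ) ≤ m := by exact_mod_cast hm.1
          have hmy : (m : ℝ) ≤ y := le_trans (by exact_mod_cast hm.2) hny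
          have a := abs_harmonic_floor_sub_le (z := y / m) (by
            rw [le_div_iff₀ (by linarith)]; linarith)
          rw [Nat.floor_div_natCast] at a
          rw [abs_mul, abs_div, abs_of_nonneg (show (0 : ℝ) ≤ m by linarith)]
          calc _ ≤ 1 / (m : ℝ) * (2 / (y / m)) := by
                gcongr
                exact abs_coprimeMoebius_le_one r m
            _ = 2 / y := by field_simp
      _ = n * (2 / y) := by simp
      _ ≤ y * (2 / y) := by gcongr
      _ = 2 := by field_simp
  have h5 : ∑ m ∈ Finset.Icc 1 n, coprimeMoebius r m / m * Real.log (y / m)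
      = ∑ m ∈ Finset.Icc 1 n, coprimeMoebius r m / m * (harmonic (n / m) : ℝ)
        - Real.eulerMascheroniConstant * ∑ m ∈ Finset.Icc 1 n, coprimeMoebius r m / m
        - ∑ m ∈ Finset.Icc 1 n, coprimeMoebius r m / m * ((harmonic (n / m) : ℝ)
      - Real.log (y / m) - Real.eulerMascheroniConstant) := by
    rw [Finset.mul_sum, ← Finset.sum_sub_distrib, ← Finset.sum_sub_distrib]
    exact Finset.sum_congr rfl fun m _ => by ring
  rw [h5]
  -- The three bounds add to `2w + 2 + 2`, which is at most `6w` because `w ≥ 1`.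
  have h6 := one_le_invDivisorSum hr
  have h7 := abs_sub (∑ m ∈ Finset.Icc 1 n, coprimeMoebius r m / m * (harmonic (n / m) : ℝ)
        - Real.eulerMascheroniConstant * ∑ m ∈ Finset.Icc 1 n, coprimeMoebius r m / m)
        (∑ m ∈ Finset.Icc 1 n, coprimeMoebius r m / m * ((harmonic (n / m) : ℝ)
      - Real.log (y / m) - Real.eulerMascheroniConstant))
  have h8 := abs_sub (∑ m ∈ Finset.Icc 1 n, coprimeMoebius r m / m * (harmonic (n / m) : ℝ))
        (Real.eulerMascheroniConstant * ∑ m ∈ Finset.Icc 1 n, coprimeMoebius r m / m)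
  linarith

/-! ### Smoothly weighted sums of the Möbius function -/

/-- Taylor's formula at 0 with integral remainder. The truncation `max (l - s) 0` makes the range of
integration independent of `l`, so that the integral can be exchanged with a sum over `m` in which
`l = log(x/m)`. -/
theorem taylor_max_integral {g g' g'' : ℝ → ℂ} (hg : ∀ t, HasDerivAt g (g' t) t)
    (hg' : ∀ t, HasDerivAt g' (g'' t) t) (hc : Continuous g'') (h0 : g 0 = 0) {l X : ℝ}
    (hl : 0 ≤ l) (hlX : l ≤ X) :
    g l = g' 0 * (l : ℂ) + ∫ s in (0 : ℝ)..X, g'' s * ((max (l - s) 0 : ℝ) : ℂ) := by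
  have hcont : Continuous fun s : ℝ => g'' s * ((max (l - s) 0 : ℝ) : ℂ) := by fun_prop
  have h1 : ∫ s in (0 : ℝ)..l, g'' s * ((max (l - s) 0 : ℝ) : ℂ)
      = ∫ s in (0 : ℝ)..l, g'' s * ((l : ℂ) - s) := by
    refine intervalIntegral.integral_congr fun s hs => ?_
    rw [Set.uIcc_of_le hl] at hs
    rw [max_eq_left (by linarith [hs.2])]
    push_cast; rfl
  have h2 : ∫ s in l..X, g'' s * ((max (l - s) 0 : ℝ) : ℂ) = 0 := by
    rw [intervalIntegral.integral_congr (g := fun _ => (0 : ℂ))]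
    · simp
    · intro s hs
      rw [Set.uIcc_of_le hlX] at hs
      beta_reduce
      rw [max_eq_right (by linarith [hs.1])]
      simp
  have h3 : ∫ s in (0 : ℝ)..l, g'' s * ((l : ℂ) - s)
      = (g' l * ((l : ℂ) - l) + g l) - (g' 0 * ((l : ℂ) - (0 : ℝ)) + g 0) := by
    refine intervalIntegral.integral_eq_sub_of_hasDerivAt
      (f := fun s : ℝ => g' s * ((l : ℂ) - s) + g s) (fun s _ => ?_) ?_
    · have := ((hg' s).mul ((hasDerivAt_const s (l : ℂ)).sub
        (hasDerivAt_id s).ofReal_comp)).add (hg s)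
      refine this.congr_deriv ?_
      simp
    · exact Continuous.intervalIntegrable (by fun_prop) _ _
  rw [← intervalIntegral.integral_add_adjacent_intervals (hcont.intervalIntegrable 0 l)
    (hcont.intervalIntegrable l X), h1, h2, h3, h0]
  simp

/-- Since `log(x/m) - s = log(x e^(-s)/m)`, truncating at 0 amounts to shortening the sum to `m ≤ x
e^(-s)`. The uniform bound for logarithmic weights thus applies for every `s`. -/
theorem sum_coprimeMoebius_max_eq (r : ℕ) {x s : ℝ} (hx : 0 < x) (hs : 0 ≤ s) :
    ∑ m ∈ Finset.Icc 1 ⌊x⌋₊, coprimeMoebius r m / m * max (Real.log (x / m) - s) 0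
      = ∑ m ∈ Finset.Icc 1 ⌊x * Real.exp (-s)⌋₊,
          coprimeMoebius r m / m * Real.log (x * Real.exp (-s) / m) := by
  have hy : 0 < x * Real.exp (-s) := mul_pos hx (Real.exp_pos _)
  have hle : x * Real.exp (-s) ≤ x := by
    have : Real.exp (-s) ≤ 1 := Real.exp_le_one_iff.2 (by linarith)
    nlinarith
  have hlog : ∀ m : ℕ, 1 ≤ m → Real.log (x / m) - s = Real.log (x * Real.exp (-s) / m) := by
    intro m hm
    have : (m : ℝ) ≠ 0 := by positivity
    rw [Real.log_div hx.ne' this, Real.log_div hy.ne' this, Real.log_mul hx.ne' (Real.exp_ne_zero _),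
      Real.log_exp]
    ring
  symm
  rw [← Finset.sum_subset (Finset.Icc_subset_Icc_right (Nat.floor_le_floor hle))]
  · refine Finset.sum_congr rfl fun m hm => ?_
    rw [Finset.mem_Icc] at hm
    rw [hlog m hm.1, max_eq_left]
    apply Real.log_nonneg
    have hm' : (0 : ℝ) < m := by exact_mod_cast hm.1
    rw [le_div_iff₀ hm', one_mul]
    exact (Nat.le_floor_iff hy.le).1 hm.2
  · intro m hm hm'
    rw [Finset.mem_Icc] at hm hm'
    have hm1 : (0 : ℝ) < m := by exact_mod_cast hm.1
    rw [hlog m hm.1, max_eq_right, mul_zero]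
    apply Real.log_nonpos (by positivity)
    rw [div_le_one hm1]
    by_contra hcon
    exact hm' ⟨hm.1, Nat.le_floor (not_le.1 hcon).le⟩

theorem norm_sum_coprimeMoebius_mul_le {g g' g'' : ℝ → ℂ} (hg : ∀ t, HasDerivAt g (g' t) t)
    (hg' : ∀ t, HasDerivAt g' (g'' t) t) (hc : Continuous g'') (h0 : g 0 = 0) {r : ℕ} (hr : r ≠ 0)
    {x D₁ D₂ : ℝ} (hx : 1 ≤ x) (hD₁ : ‖g' 0‖ ≤ D₁)
    (hD₂ : ∀ s, 0 ≤ s → s ≤ Real.log x → ‖g'' s‖ ≤ D₂) :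
    ‖∑ m ∈ Finset.Icc 1 ⌊x⌋₊, ((coprimeMoebius r m / m : ℝ) : ℂ) * g (Real.log (x / m))‖
      ≤ 6 * invDivisorSum r * (D₁ + D₂ * Real.log x) := by
  have hx0 : 0 < x := by linarith
  have hX : 0 ≤ Real.log x := Real.log_nonneg hx
  have hw := invDivisorSum_nonneg r
  have key : ∑ m ∈ Finset.Icc 1 ⌊x⌋₊, ((coprimeMoebius r m / m : ℝ) : ℂ) * g (Real.log (x / m))
      = g' 0 * ((∑ m ∈ Finset.Icc 1 ⌊x⌋₊, coprimeMoebius r m / m * Real.log (x / m) : ℝ) : ℂ)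
        + ∫ s in (0 : ℝ)..Real.log x, g'' s * ((∑ m ∈ Finset.Icc 1 ⌊x⌋₊,
            coprimeMoebius r m / m * max (Real.log (x / m) - s) 0 : ℝ) : ℂ) := by
    have e : ∀ s : ℝ, g'' s * ((∑ m ∈ Finset.Icc 1 ⌊x⌋₊,
            coprimeMoebius r m / m * max (Real.log (x / m) - s) 0 : ℝ) : ℂ)
        = ∑ m ∈ Finset.Icc 1 ⌊x⌋₊, ((coprimeMoebius r m / m : ℝ) : ℂ)
          * (g'' s * ((max (Real.log (x / m) - s) 0 : ℝ) : ℂ)) := by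
      intro s
      rw [Complex.ofReal_sum, Finset.mul_sum]
      refine Finset.sum_congr rfl fun m _ => ?_
      rw [Complex.ofReal_mul]; ring
    simp only [e]
    rw [intervalIntegral.integral_finsetSum]
    · rw [Complex.ofReal_sum, Finset.mul_sum, ← Finset.sum_add_distrib]
      refine Finset.sum_congr rfl fun m hm => ?_
      rw [Finset.mem_Icc] at hm
      have hm1 : (1 : ℝ) ≤ m := by exact_mod_cast hm.1
      have hmx : (m : ℝ) ≤ x := (Nat.le_floor_iff hx0.le).1 hm.2
      rw [intervalIntegral.integral_const_mul,
        taylor_max_integral hg hg' hc h0 (l := Real.log (x / m)) (X := Real.log x)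
          (Real.log_nonneg (by rw [le_div_iff₀] <;> linarith))
          (Real.log_le_log (by positivity) (div_le_self hx0.le hm1)), Complex.ofReal_mul]
      ring
    · intro m _
      exact Continuous.intervalIntegrable (by fun_prop) _ _
  have hI : ‖∫ s in (0 : ℝ)..Real.log x, g'' s * ((∑ m ∈ Finset.Icc 1 ⌊x⌋₊,
            coprimeMoebius r m / m * max (Real.log (x / m) - s) 0 : ℝ) : ℂ)‖
      ≤ D₂ * (6 * invDivisorSum r) * |Real.log x - 0| := by
    refine intervalIntegral.norm_integral_le_of_norm_le_const fun s hs => ?_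
    rw [Set.uIoc_of_le hX] at hs
    rw [norm_mul, sum_coprimeMoebius_max_eq r hx0 hs.1.le, Complex.norm_real, Real.norm_eq_abs]
    have h1 := hD₂ s hs.1.le hs.2
    exact mul_le_mul h1 (abs_sum_coprimeMoebius_log_le hr _) (abs_nonneg _)
      ((norm_nonneg _).trans h1)
  rw [sub_zero, abs_of_nonneg hX] at hI
  have hM : ‖g' 0 * ((∑ m ∈ Finset.Icc 1 ⌊x⌋₊,
      coprimeMoebius r m / m * Real.log (x / m) : ℝ) : ℂ)‖ ≤ D₁ * (6 * invDivisorSum r) := by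
    rw [norm_mul, Complex.norm_real, Real.norm_eq_abs]
    exact mul_le_mul hD₁ (abs_sum_coprimeMoebius_log_le hr _) (abs_nonneg _)
      ((norm_nonneg _).trans hD₁)
  rw [key]
  refine (norm_add_le _ _).trans ?_
  nlinarith

/-! ### Polynomial weights with small complex shifts -/

theorem exists_norm_eval_le (Q : Polynomial ℂ) :
    ∃ B : ℝ, 0 ≤ B ∧ ∀ u : ℝ, 0 ≤ u → u ≤ 1 → ‖Q.eval (u : ℂ)‖ ≤ B := by
  obtain ⟨B, hB⟩ := (isCompact_Icc (a := (0 : ℝ)) (b := 1)).exists_bound_of_continuousOn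
    (f := fun u : ℝ => Q.eval (u : ℂ)) (by fun_prop)
  exact ⟨B, (norm_nonneg _).trans (hB 0 (by simp)), fun u h0 h1 => hB u ⟨h0, h1⟩⟩

theorem norm_exp_mul_ofReal_le {α : ℂ} {t L C : ℝ} (ht : |t| ≤ L) (hα : ‖α‖ * L ≤ C) :
    ‖Complex.exp (α * t)‖ ≤ Real.exp C := by
  rw [Complex.norm_exp]
  apply Real.exp_le_exp.2
  calc (α * (t : ℂ)).re ≤ ‖α * (t : ℂ)‖ := Complex.re_le_norm _
    _ = ‖α‖ * |t| := by rw [norm_mul, Complex.norm_real, Real.norm_eq_abs]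
    _ ≤ ‖α‖ * L := by gcongr
    _ ≤ C := hα

theorem norm_natCast_cpow_le {α : ℂ} {m : ℕ} {L C : ℝ} (hm : 1 ≤ m) (hmL : Real.log m ≤ L)
    (hα : ‖α‖ * L ≤ C) : ‖(m : ℂ) ^ α‖ ≤ Real.exp C := by
  rw [Complex.cpow_def_of_ne_zero (by exact_mod_cast (by omega : m ≠ 0)), ← Complex.ofReal_natCast,
    ← Complex.ofReal_log (by positivity), mul_comm]
  refine norm_exp_mul_ofReal_le ?_ hα
  rwa [abs_of_nonneg (Real.log_natCast_nonneg m)]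

/-- `1 / d ^ (1 + α)`. -/
noncomputable def shiftedInv (α : ℂ) (d : ℕ) : ℂ := (d : ℂ)⁻¹ * (d : ℂ) ^ (-α)

theorem shiftedInv_mul (α : ℂ) (a b : ℕ) :
    shiftedInv α (a * b) = shiftedInv α a * shiftedInv α b := by
  rw [shiftedInv, shiftedInv, shiftedInv, Nat.cast_mul, Complex.natCast_mul_natCast_cpow, mul_inv]
  ring

theorem norm_shiftedInv_le {α : ℂ} {d : ℕ} {L C : ℝ} (hd : 1 ≤ d) (hdL : Real.log d ≤ L)
    (hα : ‖α‖ * L ≤ C) : ‖shiftedInv α d‖ ≤ Real.exp C / d := by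
  rw [shiftedInv, norm_mul, norm_inv, Complex.norm_natCast, inv_mul_eq_div]
  gcongr
  exact norm_natCast_cpow_le hd hdL (by rwa [norm_neg])

/-- Mollifier sums with a polynomial weight vanishing at the end point save a logarithm. -/
theorem exists_norm_mollifier_le (Q : Polynomial ℂ) (hQ : Q.eval 0 = 0) (C : ℝ) (hC : 0 ≤ C) :
    ∃ K : ℝ, 0 ≤ K ∧ ∀ (L : ℝ) (α : ℂ) (r : ℕ) (x : ℝ), 0 < L → ‖α‖ * L ≤ C → r ≠ 0 →
      0 < x → Real.log x ≤ L →
      ‖∑ m ∈ Finset.Icc 1 ⌊x⌋₊, (coprimeMoebius r m : ℂ) * shiftedInv α m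
          * Q.eval ((Real.log (x / m) / L : ℝ) : ℂ)‖ ≤ K * invDivisorSum r / L := by
  obtain ⟨B, hB0, hB⟩ := exists_norm_eval_le Q
  obtain ⟨B', hB'0, hB'⟩ := exists_norm_eval_le (Polynomial.derivative Q)
  obtain ⟨B'', hB''0, hB''⟩ := exists_norm_eval_le (Polynomial.derivative (Polynomial.derivative Q))
  refine ⟨Real.exp C * (6 * (B' + Real.exp C * (C ^ 2 * B + 2 * C * B' + B''))), by positivity, ?_⟩
  intro L α r x hL hα hr hx hxL
  rcases lt_or_ge x 1 with hx1 | hx1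
  · rw [Nat.floor_eq_zero.2 hx1]
    have := invDivisorSum_nonneg r
    simp only [Finset.Icc_eq_empty_of_lt zero_lt_one, Finset.sum_empty, norm_zero]
    positivity
  have hL0 : (L : ℂ) ≠ 0 := by exact_mod_cast hL.ne'
  have hlx : 0 ≤ Real.log x := Real.log_nonneg hx1
  -- The shift is absorbed in the weight: `m^(-α) = x^(-α) e^(α log(x/m))`, so up to the bounded
  -- factor `x^(-α)` the weight is `G(log(x/m))`.
  set G : ℂ → ℂ := fun z => Complex.exp (α * z) * Q.eval (z / L) with hG
  set G' : ℂ → ℂ := fun z => Complex.exp (α * z) * (α * Q.eval (z / L)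
    + (Polynomial.derivative Q).eval (z / L) / L) with hG'
  set G'' : ℂ → ℂ := fun z => Complex.exp (α * z) * (α ^ 2 * Q.eval (z / L)
    + 2 * α * (Polynomial.derivative Q).eval (z / L) / L
    + (Polynomial.derivative (Polynomial.derivative Q)).eval (z / L) / L ^ 2) with hG''
  have hexp : ∀ z, HasDerivAt (fun z => Complex.exp (α * z)) (Complex.exp (α * z) * α) z := by
    intro z
    have := (((hasDerivAt_id z).const_mul α)).cexp
    simpa using this
  have hpoly : ∀ (R : Polynomial ℂ) (z : ℂ), HasDerivAt (fun z : ℂ => R.eval (z / L))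
      ((Polynomial.derivative R).eval (z / L) / L) z := by
    intro R z
    have := (R.hasDerivAt (z / L)).comp z ((hasDerivAt_id z).div_const (L : ℂ))
    refine this.congr_deriv ?_
    simp only [div_eq_mul_inv, one_mul]
  have d1 : ∀ z, HasDerivAt G (G' z) z := by
    intro z
    refine ((hexp z).mul (hpoly Q z)).congr_deriv ?_
    simp only [hG']; ring
  have d2 : ∀ z, HasDerivAt G' (G'' z) z := by
    intro z
    refine ((hexp z).mul (((hpoly Q z).const_mul α).add
      ((hpoly (Polynomial.derivative Q) z).div_const (L : ℂ)))).congr_deriv ?_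
    simp only [hG'', Pi.add_apply]; field_simp; ring
  have hterm : ∀ m ∈ Finset.Icc 1 ⌊x⌋₊, (coprimeMoebius r m : ℂ) * shiftedInv α m
          * Q.eval ((Real.log (x / m) / L : ℝ) : ℂ)
      = Complex.exp (-α * Real.log x) * (((coprimeMoebius r m / m : ℝ) : ℂ)
          * G (Real.log (x / m) : ℝ)) := by
    intro m hm
    rw [Finset.mem_Icc] at hm
    have hm0 : (m : ℂ) ≠ 0 := by exact_mod_cast (by omega : m ≠ 0)
    have hm0' : (m : ℝ) ≠ 0 := by exact_mod_cast (by omega : m ≠ 0)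
    have e1 : (m : ℂ) ^ (-α) = Complex.exp (-α * Real.log x)
        * Complex.exp (α * (Real.log (x / m) : ℝ)) := by
      rw [← Complex.exp_add, Complex.cpow_def_of_ne_zero hm0, Real.log_div hx.ne' hm0',
        ← Complex.ofReal_natCast, ← Complex.ofReal_log (by positivity)]
      congr 1
      push_cast
      ring
    simp only [hG]
    rw [shiftedInv, e1]
    push_cast
    field_simp
  rw [Finset.sum_congr rfl hterm, ← Finset.mul_sum, norm_mul]
  have hE : ‖Complex.exp (-α * Real.log x)‖ ≤ Real.exp C :=
    norm_exp_mul_ofReal_le (L := L) (by rwa [abs_of_nonneg hlx]) (by rwa [norm_neg])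
  have hα' : ‖α‖ ≤ C / L := by rwa [le_div_iff₀ hL]
  -- The term `α Q(0)` vanishes, leaving `Q'(0)/L`. With `G'' = O(L⁻²)` on an interval of length at
  -- most `L`, both contributions are `O(1/L)`.
  have b1 : ‖G' ((0 : ℝ) : ℂ)‖ ≤ B' / L := by
    have := hB' 0 le_rfl zero_le_one
    rw [Complex.ofReal_zero] at this
    simp only [hG', Complex.ofReal_zero, mul_zero, Complex.exp_zero, zero_div, hQ, zero_add, one_mul]
    rw [norm_div, Complex.norm_real, Real.norm_eq_abs, abs_of_pos hL]
    gcongr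
  have b2 : ∀ s : ℝ, 0 ≤ s → s ≤ Real.log x →
      ‖G'' (s : ℂ)‖ ≤ Real.exp C * (C ^ 2 * B + 2 * C * B' + B'') / L ^ 2 := by
    intro s hs0 hs
    have hu0 : 0 ≤ s / L := by positivity
    have hu1 : s / L ≤ 1 := by rw [div_le_one hL]; linarith
    have a0 := hB _ hu0 hu1
    have a1 := hB' _ hu0 hu1
    have a2 := hB'' _ hu0 hu1
    rw [Complex.ofReal_div] at a0 a1 a2
    have a3 : ‖Complex.exp (α * s)‖ ≤ Real.exp C :=
      norm_exp_mul_ofReal_le (L := L) (by rw [abs_of_nonneg hs0]; linarith) hα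
    simp only [hG'']
    rw [norm_mul]
    calc _ ≤ Real.exp C * ((C / L) ^ 2 * B + 2 * (C / L) * B' / L + B'' / L ^ 2) := by
          gcongr
          refine (norm_add₃_le).trans ?_
          simp only [norm_mul, norm_div, norm_pow, Complex.norm_real, Real.norm_eq_abs,
            abs_of_pos hL, Complex.norm_ofNat]
          gcongr
      _ = _ := by field_simp
  have hmain := norm_sum_coprimeMoebius_mul_le (g := fun t : ℝ => G t) (g' := fun t : ℝ => G' t)
    (g'' := fun t : ℝ => G'' t) (fun t => (d1 t).comp_ofReal) (fun t => (d2 t).comp_ofReal)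
    (by simp only [hG'']; fun_prop) (by simp [hG, hQ]) hr hx1 b1 b2
  have hw := invDivisorSum_nonneg r
  have hfin : B' / L + Real.exp C * (C ^ 2 * B + 2 * C * B' + B'') / L ^ 2 * Real.log x
      ≤ (B' + Real.exp C * (C ^ 2 * B + 2 * C * B' + B'')) / L := by
    have : Real.exp C * (C ^ 2 * B + 2 * C * B' + B'') / L ^ 2 * Real.log x
        ≤ Real.exp C * (C ^ 2 * B + 2 * C * B' + B'') / L ^ 2 * L := by gcongr
    have e : Real.exp C * (C ^ 2 * B + 2 * C * B' + B'') / L ^ 2 * L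
        = Real.exp C * (C ^ 2 * B + 2 * C * B' + B'') / L := by field_simp
    rw [add_div]; linarith
  calc _ ≤ Real.exp C * (6 * invDivisorSum r
          * ((B' + Real.exp C * (C ^ 2 * B + 2 * C * B' + B'')) / L)) := by
        gcongr
        exact hmain.trans (by gcongr)
    _ = _ := by ring

/-! ### Divisor sums and averages -/

theorem invDivisorSum_mul_le (a b : ℕ) :
    invDivisorSum (a * b) ≤ invDivisorSum a * invDivisorSum b := by
  rcases eq_or_ne (a * b) 0 with h0 | h0
  · rw [h0]
    simpa [invDivisorSum] using mul_nonneg (invDivisorSum_nonneg a) (invDivisorSum_nonneg b)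
  have h : (a * b).divisors ⊆ (a.divisors ×ˢ b.divisors).image (fun x => x.1 * x.2) := by
    intro d hd
    obtain ⟨x, y, hx, hy, rfl⟩ := exists_dvd_and_dvd_of_dvd_mul (Nat.dvd_of_mem_divisors hd)
    refine Finset.mem_image.2 ⟨(x, y), ?_, rfl⟩
    rw [Finset.mem_product, Nat.mem_divisors, Nat.mem_divisors]
    exact ⟨⟨hx, left_ne_zero_of_mul h0⟩, hy, right_ne_zero_of_mul h0⟩
  refine (sum_le_sum_comp_of_subset_image _ h (fun d : ℕ => (d : ℝ)⁻¹)
    fun _ => by positivity).trans (le_of_eq ?_)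
  rw [invDivisorSum, invDivisorSum, Finset.sum_mul_sum, Finset.sum_product]
  refine Finset.sum_congr rfl fun x _ => Finset.sum_congr rfl fun y _ => ?_
  push_cast
  rw [mul_inv]

theorem invDivisorSum_le_of_dvd {a b : ℕ} (h : a ∣ b) (hb : b ≠ 0) :
    invDivisorSum a ≤ invDivisorSum b :=
  Finset.sum_le_sum_of_subset_of_nonneg (Nat.divisors_subset_of_dvd hb h) fun _ _ _ => by positivity

theorem sum_range_inv_pow_le {p : ℕ} (hp : 2 ≤ p) (n : ℕ) :
    ∑ l ∈ Finset.range n, ((p ^ l : ℕ) : ℝ)⁻¹ ≤ 2 := by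
  refine le_trans (Finset.sum_le_sum fun l _ => ?_) (sum_geometric_two_le n)
  rw [Nat.cast_pow, one_div, inv_pow]
  have : (2 : ℝ) ≤ p := by exact_mod_cast hp
  gcongr

theorem invDivisorSum_primePow_le {j : ℕ} (hj : IsPrimePow j) : invDivisorSum j ≤ 2 := by
  obtain ⟨p, k, hp, -, rfl⟩ := (isPrimePow_nat_iff _).1 hj
  rw [invDivisorSum, Nat.sum_divisors_prime_pow hp]
  exact sum_range_inv_pow_le hp.two_le _

theorem sum_Icc_inv_le (n : ℕ) : ∑ m ∈ Finset.Icc 1 n, (m : ℝ)⁻¹ ≤ 1 + Real.log n := by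
  have h := harmonic_le_one_add_log n
  rw [harmonic_eq_sum_Icc] at h
  push_cast at h
  exact h

theorem sum_rpow_neg_le_tsum {η : ℝ} (hη : 1 < η) (s : Finset ℕ) :
    ∑ d ∈ s, (d : ℝ) ^ (-η) ≤ ∑' d : ℕ, (d : ℝ) ^ (-η) :=
  (Real.summable_nat_rpow.2 (by linarith)).sum_le_tsum s fun _ _ => by positivity

/-- Cauchy–Schwarz after splitting `d^(-η)` as `d^(-(η - η'/2)) d^(-η'/2)`. It trades a power of a
divisor sum for a smaller exponent. -/
theorem sum_divisors_rpow_sq_le (η η' : ℝ) (h : 1 < 2 * η - η') (r : ℕ) :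
    (∑ d ∈ r.divisors, (d : ℝ) ^ (-η)) ^ 2
      ≤ (∑' d : ℕ, (d : ℝ) ^ (-(2 * η - η'))) * ∑ d ∈ r.divisors, (d : ℝ) ^ (-η') := by
  have e : ∑ d ∈ r.divisors, (d : ℝ) ^ (-η)
      = ∑ d ∈ r.divisors, (d : ℝ) ^ (-(η - η' / 2)) * (d : ℝ) ^ (-(η' / 2)) := by
    refine Finset.sum_congr rfl fun d hd => ?_
    have hd0 : (0 : ℝ) < d := by exact_mod_cast Nat.pos_of_mem_divisors hd
    rw [← Real.rpow_add hd0]; congr 1; ring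
  rw [e]
  refine (Finset.sum_mul_sq_le_sq_mul_sq _ _ _).trans ?_
  have e2 : ∀ x : ℝ, ∑ d ∈ r.divisors, ((d : ℝ) ^ (-x)) ^ 2
      = ∑ d ∈ r.divisors, (d : ℝ) ^ (-(2 * x)) := by
    intro x
    refine Finset.sum_congr rfl fun d _ => ?_
    rw [← Real.rpow_natCast, ← Real.rpow_mul (by positivity)]; congr 1; push_cast; ring
  rw [e2, e2, show 2 * (η - η' / 2) = 2 * η - η' by ring, show 2 * (η' / 2) = η' by ring]
  exact mul_le_mul_of_nonneg_right (sum_rpow_neg_le_tsum h _)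
    (Finset.sum_nonneg fun _ _ => by positivity)

theorem exists_sum_invDivisorSum_pow_le :
    ∃ K : ℝ, 0 ≤ K ∧ ∀ n : ℕ, 1 ≤ n →
      ∑ r ∈ Finset.Icc 1 n, invDivisorSum r ^ 3 / r ≤ K * (1 + Real.log n) := by
  set S : ℝ := ∑' d : ℕ, (d : ℝ) ^ (-(6 / 5 : ℝ)) with hS
  set S' : ℝ := ∑' d : ℕ, (d : ℝ) ^ (-(7 / 5 : ℝ)) with hS'
  have hS0 : 0 ≤ S := tsum_nonneg fun _ => by positivity
  have hS'0 : 0 ≤ S' := tsum_nonneg fun _ => by positivity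
  have hpt : ∀ r : ℕ, r ≠ 0 → invDivisorSum r ^ 3
      ≤ S ^ 2 * S * ∑ d ∈ r.divisors, (d : ℝ) ^ (-(2 / 5 : ℝ)) := by
    intro r hr
    -- Two applications, with exponents `1 → 4/5 → 2/5`, bound `w(r)⁴` by one divisor sum. Both
    -- convergence exponents equal `6/5`, and after division by `r` the final exponent `7/5` also
    -- exceeds 1.
    have h1 := sum_divisors_rpow_sq_le 1 (4 / 5) (by norm_num) r
    have h2 := sum_divisors_rpow_sq_le (4 / 5) (2 / 5) (by norm_num) r
    rw [show (2 * 1 - 4 / 5 : ℝ) = 6 / 5 by norm_num, ← hS] at h1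
    rw [show (2 * (4 / 5) - 2 / 5 : ℝ) = 6 / 5 by norm_num, ← hS] at h2
    have e : ∑ d ∈ r.divisors, (d : ℝ) ^ (-(1 : ℝ)) = invDivisorSum r :=
      Finset.sum_congr rfl fun d _ => Real.rpow_neg_one _
    rw [e] at h1
    have hw := one_le_invDivisorSum hr
    calc invDivisorSum r ^ 3 ≤ invDivisorSum r ^ 4 := pow_le_pow_right₀ hw (by norm_num)
      _ = (invDivisorSum r ^ 2) ^ 2 := by ring
      _ ≤ (S * ∑ d ∈ r.divisors, (d : ℝ) ^ (-(4 / 5 : ℝ))) ^ 2 := by gcongr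
      _ = S ^ 2 * (∑ d ∈ r.divisors, (d : ℝ) ^ (-(4 / 5 : ℝ))) ^ 2 := by ring
      _ ≤ S ^ 2 * (S * ∑ d ∈ r.divisors, (d : ℝ) ^ (-(2 / 5 : ℝ))) := by gcongr
      _ = _ := by ring
  refine ⟨S ^ 2 * S * S', by positivity, fun n hn => ?_⟩
  have hlog := Real.log_natCast_nonneg n
  calc ∑ r ∈ Finset.Icc 1 n, invDivisorSum r ^ 3 / r
      ≤ ∑ r ∈ Finset.Icc 1 n, ∑ d ∈ r.divisors, S ^ 2 * S * ((d : ℝ) ^ (-(2 / 5 : ℝ)) / r) := by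
        refine Finset.sum_le_sum fun r hr => ?_
        rw [Finset.mem_Icc] at hr
        rw [← Finset.mul_sum, ← Finset.sum_div, ← mul_div_assoc]
        gcongr
        exact hpt r (by omega)
    _ = ∑ d ∈ Finset.Icc 1 n, ∑ m ∈ Finset.Icc 1 (n / d),
          S ^ 2 * S * ((d : ℝ) ^ (-(2 / 5 : ℝ)) / (d * m : ℕ)) :=
        sum_Icc_sum_divisors' n (fun d r => S ^ 2 * S * ((d : ℝ) ^ (-(2 / 5 : ℝ)) / r))
    _ ≤ ∑ d ∈ Finset.Icc 1 n, S ^ 2 * S * ((d : ℝ) ^ (-(7 / 5 : ℝ)) * (1 + Real.log n)) := by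
        refine Finset.sum_le_sum fun d hd => ?_
        rw [Finset.mem_Icc] at hd
        have hd0 : (0 : ℝ) < d := by exact_mod_cast hd.1
        rw [← Finset.mul_sum]
        gcongr
        have e : ∀ m : ℕ, (d : ℝ) ^ (-(2 / 5 : ℝ)) / (d * m : ℕ)
            = (d : ℝ) ^ (-(7 / 5 : ℝ)) * (m : ℝ)⁻¹ := by
          intro m
          rw [show (-(7 / 5) : ℝ) = -(2 / 5) - 1 by norm_num, Real.rpow_sub_one hd0.ne']
          push_cast
          rw [div_mul_eq_div_div]; ring
        simp only [e]
        rw [← Finset.mul_sum]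
        gcongr
        exact (Finset.sum_le_sum_of_subset_of_nonneg
          (Finset.Icc_subset_Icc_right (Nat.div_le_self n d)) fun _ _ _ => by positivity).trans
          (sum_Icc_inv_le n)
    _ = S ^ 2 * S * (∑ d ∈ Finset.Icc 1 n, (d : ℝ) ^ (-(7 / 5 : ℝ))) * (1 + Real.log n) := by
        rw [← Finset.mul_sum, ← Finset.sum_mul]; ring
    _ ≤ S ^ 2 * S * S' * (1 + Real.log n) := by
        gcongr
        exact sum_rpow_neg_le_tsum (by norm_num) _

/-! ### Von Mangoldt sums weighted by a greatest common divisor -/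

/-- Chebyshev's argument: the sum of `Λ(j)⌊n/j⌋` is `log n! ≤ n log n`, and `n/j ≤ 2⌊n/j⌋` for `j ≤
n`. -/
theorem sum_vonMangoldt_div_le (n : ℕ) :
    ∑ j ∈ Finset.Icc 1 n, vonMangoldt j / j ≤ 2 * Real.log n := by
  rcases Nat.eq_zero_or_pos n with rfl | hn
  · simp
  have hn' : (0 : ℝ) < n := by exact_mod_cast hn
  have h1 : ∑ j ∈ Finset.Icc 1 n, vonMangoldt j * ((n / j : ℕ) : ℝ) ≤ n * Real.log n := by
    have e : ∑ k ∈ Finset.Icc 1 n, ∑ d ∈ k.divisors, vonMangoldt d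
        = ∑ j ∈ Finset.Icc 1 n, vonMangoldt j * ((n / j : ℕ) : ℝ) := by
      rw [sum_Icc_sum_divisors' n (fun d _ => vonMangoldt d)]
      refine Finset.sum_congr rfl fun j _ => ?_
      simp [mul_comm]
    rw [← e]
    calc _ ≤ ∑ k ∈ Finset.Icc 1 n, Real.log n := by
          refine Finset.sum_le_sum fun k hk => ?_
          rw [Finset.mem_Icc] at hk
          rw [vonMangoldt_sum]
          exact Real.log_le_log (by exact_mod_cast hk.1) (by exact_mod_cast hk.2)
      _ = n * Real.log n := by simp
  have h2 : n * ∑ j ∈ Finset.Icc 1 n, vonMangoldt j / j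
      ≤ 2 * ∑ j ∈ Finset.Icc 1 n, vonMangoldt j * ((n / j : ℕ) : ℝ) := by
    rw [Finset.mul_sum, Finset.mul_sum]
    refine Finset.sum_le_sum fun j hj => ?_
    rw [Finset.mem_Icc] at hj
    have hj0 : (0 : ℝ) < j := by exact_mod_cast hj.1
    have h3 : n ≤ 2 * (n / j) * j := by
      have a1 := Nat.lt_mul_div_succ n (show 0 < j by omega)
      have a2 : 1 ≤ n / j := (Nat.one_le_div_iff (by omega)).2 hj.2
      nlinarith
    have h4 : (n : ℝ) ≤ 2 * ((n / j : ℕ) : ℝ) * j := by exact_mod_cast h3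
    calc (n : ℝ) * (vonMangoldt j / j) = vonMangoldt j * (n / j) := by ring
      _ ≤ vonMangoldt j * (2 * ((n / j : ℕ) : ℝ)) := by
          gcongr
          rwa [div_le_iff₀ hj0]
      _ = _ := by ring
  have h5 : n * ∑ j ∈ Finset.Icc 1 n, vonMangoldt j / j ≤ n * (2 * Real.log n) := by linarith
  exact le_of_mul_le_mul_left h5 hn'

/-- If `Λ(gm) ≠ 0` with `g ≥ 2`, then `g` and `m` are powers of the same prime `g.minFac` and `Λ(gm)
= Λ(g)`; the sum over `m` is geometric. -/
theorem sum_vonMangoldt_multiples_le {g : ℕ} (hg : 2 ≤ g) (n : ℕ) :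
    ∑ j ∈ Finset.Icc 1 n with g ∣ j, vonMangoldt j * (g / j) ≤ 2 * vonMangoldt g := by
  rw [sum_Icc_filter_dvd n g (by omega)]
  set s := (Finset.range (n + 1)).image (fun l => g.minFac ^ l) with hs
  have hp : g.minFac.Prime := Nat.minFac_prime (by omega)
  have hg0 : (0 : ℝ) < g := by positivity
  calc ∑ m ∈ Finset.Icc 1 (n / g), vonMangoldt (g * m) * (g / (g * m : ℕ))
      ≤ ∑ m ∈ Finset.Icc 1 (n / g), if m ∈ s then vonMangoldt g * (m : ℝ)⁻¹ else 0 := by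
        refine Finset.sum_le_sum fun m hm => ?_
        rw [Finset.mem_Icc] at hm
        have e : ((g : ℝ) / (g * m : ℕ)) = (m : ℝ)⁻¹ := by push_cast; field_simp
        rw [e]
        by_cases hpp : IsPrimePow (g * m)
        · obtain ⟨p, k, hpr, hk, he⟩ := (isPrimePow_nat_iff _).1 hpp
          obtain ⟨i, hi, rfl⟩ := (Nat.dvd_prime_pow hpr).1 (he ▸ dvd_mul_right g m)
          obtain ⟨l, hl, rfl⟩ := (Nat.dvd_prime_pow hpr).1 (he ▸ dvd_mul_left m (p ^ i))
          have hi0 : i ≠ 0 := by rintro rfl; simp at hg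
          have hmf : (p ^ i).minFac = p := hpr.pow_minFac hi0
          have hln : l < n + 1 := by
            have h1 : l < p ^ l := Nat.lt_pow_self hpr.one_lt
            have h2 : n / p ^ i ≤ n := Nat.div_le_self _ _
            omega
          rw [if_pos]
          · rw [← pow_add, vonMangoldt_apply_pow (by omega), vonMangoldt_apply_pow hi0]
          · rw [hs, hmf]
            exact Finset.mem_image.2 ⟨l, Finset.mem_range.2 hln, rfl⟩
        · rw [vonMangoldt_eq_zero_iff.2 hpp, zero_mul]
          split_ifs
          · exact mul_nonneg vonMangoldt_nonneg (by positivity)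
          · exact le_rfl
    _ = ∑ m ∈ Finset.Icc 1 (n / g) with m ∈ s, vonMangoldt g * (m : ℝ)⁻¹ :=
        (Finset.sum_filter _ _).symm
    _ ≤ ∑ l ∈ Finset.range (n + 1), vonMangoldt g * ((g.minFac ^ l : ℕ) : ℝ)⁻¹ := by
        refine sum_le_sum_comp_of_subset_image (fun l => g.minFac ^ l) ?_
          (fun m : ℕ => vonMangoldt g * (m : ℝ)⁻¹)
          fun _ => mul_nonneg vonMangoldt_nonneg (by positivity)
        exact fun m hm => (Finset.mem_filter.1 hm).2
    _ ≤ vonMangoldt g * 2 := by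
        rw [← Finset.mul_sum]
        exact mul_le_mul_of_nonneg_left (sum_range_inv_pow_le hp.two_le _) vonMangoldt_nonneg
    _ = _ := mul_comm _ _

theorem gcd_le_sum_divisors {r j : ℕ} (hr : r ≠ 0) :
    (Nat.gcd r j : ℝ) ≤ ∑ g ∈ r.divisors, if g ∣ j then (g : ℝ) else 0 := by
  have h := Finset.single_le_sum (s := r.divisors)
    (f := fun g : ℕ => if g ∣ j then (g : ℝ) else 0)
    (fun g _ => by split_ifs <;> positivity)
    (Nat.mem_divisors.2 ⟨Nat.gcd_dvd_left r j, hr⟩)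
  simpa [Nat.gcd_dvd_right] using h

/-- Bound `(r,j)` by the sum of the common divisors `g`. The divisor `g = 1` gives a Chebyshev sum;
the others give `2Λ(g)`, which sum over `g ∣ r` to `2 log r`. So the bound is uniform in `r`. -/
theorem sum_vonMangoldt_gcd_le {r n : ℕ} (hr : 1 ≤ r) (hrn : r ≤ n) :
    ∑ j ∈ Finset.Icc 1 n, vonMangoldt j * (Nat.gcd r j / j) ≤ 4 * Real.log n := by
  calc ∑ j ∈ Finset.Icc 1 n, vonMangoldt j * (Nat.gcd r j / j)
      ≤ ∑ j ∈ Finset.Icc 1 n, ∑ g ∈ r.divisors,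
          if g ∣ j then vonMangoldt j * ((g : ℝ) / j) else 0 := by
        refine Finset.sum_le_sum fun j _ => ?_
        have h := gcd_le_sum_divisors (r := r) (j := j) (by omega)
        calc _ ≤ vonMangoldt j * ((∑ g ∈ r.divisors, if g ∣ j then (g : ℝ) else 0) / j) := by
              gcongr
          _ = _ := by
              rw [Finset.sum_div, Finset.mul_sum]
              refine Finset.sum_congr rfl fun g _ => ?_
              split_ifs <;> simp
    _ = ∑ g ∈ r.divisors, ∑ j ∈ Finset.Icc 1 n with g ∣ j, vonMangoldt j * ((g : ℝ) / j) := by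
        rw [Finset.sum_comm]
        exact Finset.sum_congr rfl fun g _ => (Finset.sum_filter _ _).symm
    _ ≤ ∑ g ∈ r.divisors, ((if g = 1 then 2 * Real.log n else 0) + 2 * vonMangoldt g) := by
        refine Finset.sum_le_sum fun g hg => ?_
        have hg0 := Nat.pos_of_mem_divisors hg
        split_ifs with h
        · subst h
          have h1 : ∑ j ∈ Finset.Icc 1 n with 1 ∣ j, vonMangoldt j * (((1 : ℕ) : ℝ) / j)
              = ∑ j ∈ Finset.Icc 1 n, vonMangoldt j / j := by
            rw [Finset.filter_true_of_mem fun _ _ => one_dvd _]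
            exact Finset.sum_congr rfl fun j _ => by rw [Nat.cast_one, mul_one_div]
          rw [h1]
          have := sum_vonMangoldt_div_le n
          have h2 : 0 ≤ vonMangoldt 1 := vonMangoldt_nonneg
          linarith
        · rw [zero_add]
          exact sum_vonMangoldt_multiples_le (by omega) n
    _ = 2 * Real.log n + 2 * Real.log r := by
        rw [Finset.sum_add_distrib, ← Finset.mul_sum, vonMangoldt_sum, Finset.sum_ite_eq',
          if_pos (Nat.one_mem_divisors.2 (by omega))]
    _ ≤ 4 * Real.log n := by
        have : Real.log r ≤ Real.log n :=
          Real.log_le_log (by exact_mod_cast hr) (by exact_mod_cast hrn)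
        linarith

theorem sum_vonMangoldt_sq_gcd_le {r n : ℕ} (hr : 1 ≤ r) (hrn : r ≤ n) :
    ∑ j ∈ Finset.Icc 1 n, vonMangoldt j ^ 2 * (Nat.gcd r j / j) ≤ 4 * Real.log n ^ 2 := by
  calc ∑ j ∈ Finset.Icc 1 n, vonMangoldt j ^ 2 * (Nat.gcd r j / j)
      ≤ ∑ j ∈ Finset.Icc 1 n, Real.log n * (vonMangoldt j * (Nat.gcd r j / j)) := by
        refine Finset.sum_le_sum fun j hj => ?_
        rw [Finset.mem_Icc] at hj
        have h1 : vonMangoldt j ≤ Real.log n := vonMangoldt_le_log.trans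
          (Real.log_le_log (by exact_mod_cast hj.1) (by exact_mod_cast hj.2))
        rw [sq, mul_assoc]
        exact mul_le_mul_of_nonneg_right h1 (mul_nonneg vonMangoldt_nonneg (by positivity))
    _ ≤ Real.log n * (4 * Real.log n) := by
        rw [← Finset.mul_sum]
        exact mul_le_mul_of_nonneg_left (sum_vonMangoldt_gcd_le hr hrn)
          (Real.log_natCast_nonneg n)
    _ = _ := by ring

/-! ### Sums over proper prime powers -/

theorem properLambdaSq_nonneg (j : ℕ) : 0 ≤ properLambdaSq j := by
  rw [properLambdaSq]; split_ifs <;> positivity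

theorem properLambdaSq_le (j : ℕ) : properLambdaSq j ≤ vonMangoldt j ^ 2 := by
  rw [properLambdaSq]; split_ifs
  · positivity
  · exact le_rfl

theorem isPrimePow_of_properLambdaSq_ne_zero {j : ℕ} (h : properLambdaSq j ≠ 0) :
    IsPrimePow j := by
  by_contra hc
  apply h
  rw [properLambdaSq, vonMangoldt_eq_zero_iff.2 hc]; simp

/-- At a prime power both factors are powers of a logarithm: the numerator is at most `3 log³ j`.
Then `log j ≤ 12 j^(1/12)` produces `3 · 12³ = 5184`. -/
theorem properLambdaSq_mul_card_divisors_le {j : ℕ} :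
    properLambdaSq j * (j.divisors.card : ℝ) / j ≤ 5184 * (j : ℝ) ^ (-(3 / 4 : ℝ)) := by
  by_cases h : properLambdaSq j = 0
  · rw [h]; simp; positivity
  obtain ⟨p, k, hp, hk, rfl⟩ :=
    (isPrimePow_nat_iff _).1 (isPrimePow_of_properLambdaSq_ne_zero h)
  set j := p ^ k with hj
  have hj1 : (1 : ℝ) ≤ j := by exact_mod_cast Nat.one_le_pow _ _ hp.pos
  have hl0 : 0 ≤ Real.log j := Real.log_nonneg hj1
  have h1 : properLambdaSq j ≤ Real.log j ^ 2 := (properLambdaSq_le j).trans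
    (pow_le_pow_left₀ vonMangoldt_nonneg vonMangoldt_le_log 2)
  have h2 : (j.divisors.card : ℝ) ≤ 3 * Real.log j := by
    rw [hj, Nat.divisors_prime_pow hp, Finset.card_map, Finset.card_range, Nat.cast_pow,
      Real.log_pow]
    have a1 : Real.log 2 ≤ Real.log p :=
      Real.log_le_log (by norm_num) (by exact_mod_cast hp.two_le)
    have a2 := Real.log_two_gt_d9
    have a3 : (1 : ℝ) ≤ k := by exact_mod_cast hk
    push_cast
    nlinarith
  have h3 : Real.log j ≤ (j : ℝ) ^ (1 / 12 : ℝ) / (1 / 12) :=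
    Real.log_le_rpow_div (by linarith) (by norm_num)
  have h4 : ((j : ℝ) ^ (1 / 12 : ℝ)) ^ 3 = (j : ℝ) ^ (1 / 4 : ℝ) := by
    rw [← Real.rpow_natCast, ← Real.rpow_mul (by linarith)]; norm_num
  have h5 : (j : ℝ) ^ (-(3 / 4 : ℝ)) = (j : ℝ) ^ (1 / 4 : ℝ) / j := by
    rw [show (-(3 / 4) : ℝ) = 1 / 4 - 1 by norm_num, Real.rpow_sub_one (by linarith)]
  rw [h5, ← mul_div_assoc]
  refine div_le_div_of_nonneg_right ?_ (by linarith)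
  calc properLambdaSq j * (j.divisors.card : ℝ) ≤ Real.log j ^ 2 * (3 * Real.log j) := by gcongr
    _ = 3 * Real.log j ^ 3 := by ring
    _ ≤ 3 * ((j : ℝ) ^ (1 / 12 : ℝ) / (1 / 12)) ^ 3 := by gcongr
    _ = 5184 * ((j : ℝ) ^ (1 / 12 : ℝ)) ^ 3 := by ring
    _ = _ := by rw [h4]

theorem exists_sum_properLambdaSq_le :
    ∃ K : ℝ, 0 ≤ K ∧ ∀ n : ℕ, ∑ j ∈ Finset.Icc 1 n,
      properLambdaSq j * (j.divisors.card : ℝ) / j ≤ K := by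
  set S : ℝ := ∑' d : ℕ, (d : ℝ) ^ (-(3 / 2 : ℝ)) with hS
  set S' : ℝ := ∑' d : ℕ, (d : ℝ) ^ (-(9 / 4 : ℝ)) with hS'
  have hS0 : 0 ≤ S := tsum_nonneg fun _ => by positivity
  have hS'0 : 0 ≤ S' := tsum_nonneg fun _ => by positivity
  refine ⟨5184 * (S * S'), by positivity, fun n => ?_⟩
  -- A proper prime power has the form `a² b³`: `p^(2c) = (p^c)² · 1³` and `p^(2c+1) = (p^(c-1))²
  -- p³`. The exponent `3/4` then becomes `3/2` and `9/4`, both summable.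
  have hsub : (Finset.Icc 1 n).filter (fun j => properLambdaSq j ≠ 0)
      ⊆ (Finset.range (n + 1) ×ˢ Finset.range (n + 1)).image (fun x => x.1 ^ 2 * x.2 ^ 3) := by
    intro j hj
    rw [Finset.mem_filter, Finset.mem_Icc] at hj
    obtain ⟨⟨h1, h2⟩, h3⟩ := hj
    obtain ⟨p, k, hp, hk, rfl⟩ :=
      (isPrimePow_nat_iff _).1 (isPrimePow_of_properLambdaSq_ne_zero h3)
    have hk1 : k ≠ 1 := by
      rintro rfl
      apply h3
      rw [pow_one, properLambdaSq, if_pos hp]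
    have hle : ∀ i, i ≤ k → p ^ i < n + 1 := fun i hi =>
      Nat.lt_succ_of_le ((Nat.pow_le_pow_right hp.pos hi).trans h2)
    rcases Nat.even_or_odd' k with ⟨c, hc | hc⟩
    · refine Finset.mem_image.2 ⟨(p ^ c, p ^ 0), ?_, ?_⟩
      · rw [Finset.mem_product, Finset.mem_range, Finset.mem_range]
        exact ⟨hle _ (by omega), hle _ (by omega)⟩
      · rw [hc]; ring
    · refine Finset.mem_image.2 ⟨(p ^ (c - 1), p ^ 1), ?_, ?_⟩
      · rw [Finset.mem_product, Finset.mem_range, Finset.mem_range]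
        exact ⟨hle _ (by omega), hle _ (by omega)⟩
      · simp only
        rw [← pow_mul, ← pow_mul, ← pow_add]; congr 1; omega
  calc _ = ∑ j ∈ Finset.Icc 1 n with properLambdaSq j ≠ 0,
          properLambdaSq j * (j.divisors.card : ℝ) / j := by
        refine (Finset.sum_filter_of_ne (p := fun j => properLambdaSq j ≠ 0)
          fun j _ h h' => h ?_).symm
        rw [h']; simp
    _ ≤ ∑ j ∈ Finset.Icc 1 n with properLambdaSq j ≠ 0, 5184 * (j : ℝ) ^ (-(3 / 4 : ℝ)) :=
        Finset.sum_le_sum fun j _ => properLambdaSq_mul_card_divisors_le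
    _ ≤ ∑ x ∈ Finset.range (n + 1) ×ˢ Finset.range (n + 1),
          5184 * ((x.1 ^ 2 * x.2 ^ 3 : ℕ) : ℝ) ^ (-(3 / 4 : ℝ)) :=
        sum_le_sum_comp_of_subset_image _ hsub
          (fun j : ℕ => 5184 * (j : ℝ) ^ (-(3 / 4 : ℝ))) fun _ => by positivity
    _ = 5184 * ((∑ a ∈ Finset.range (n + 1), (a : ℝ) ^ (-(3 / 2 : ℝ)))
          * ∑ b ∈ Finset.range (n + 1), (b : ℝ) ^ (-(9 / 4 : ℝ))) := by
        rw [Finset.sum_product, Finset.sum_mul_sum, Finset.mul_sum]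
        refine Finset.sum_congr rfl fun a _ => ?_
        rw [Finset.mul_sum]
        refine Finset.sum_congr rfl fun b _ => ?_
        rw [Nat.cast_mul, Nat.cast_pow, Nat.cast_pow,
          Real.mul_rpow (by positivity) (by positivity), ← Real.rpow_natCast, ← Real.rpow_natCast,
          ← Real.rpow_mul (by positivity), ← Real.rpow_mul (by positivity)]
        norm_num
    _ ≤ 5184 * (S * S') := by
        gcongr
        · exact sum_rpow_neg_le_tsum (by norm_num) _
        · exact sum_rpow_neg_le_tsum (by norm_num) _

theorem exists_sum_invDivisorSum_properLambdaSq_le :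
    ∃ K : ℝ, 0 ≤ K ∧ ∀ n : ℕ, 1 ≤ n →
      ∑ r ∈ Finset.Icc 1 n, invDivisorSum r ^ 3 / r
        * ∑ j ∈ Finset.Icc 1 n, properLambdaSq j * (Nat.gcd r j / j) ≤ K * (1 + Real.log n) := by
  obtain ⟨K₁, hK₁, h₁⟩ := exists_sum_invDivisorSum_pow_le
  obtain ⟨K₂, hK₂, h₂⟩ := exists_sum_properLambdaSq_le
  refine ⟨8 * K₁ * K₂, by positivity, fun n hn => ?_⟩
  set A := K₁ * (1 + Real.log n) with hA
  have hA0 : 0 ≤ A := mul_nonneg hK₁ (by have := Real.log_natCast_nonneg n; linarith)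
  have hwn : ∀ r, 0 ≤ invDivisorSum r := invDivisorSum_nonneg
  -- With `r = g m`, submultiplicativity of `w` separates `g` from `m`, and the factor `g` cancels.
  have inner : ∀ g : ℕ, 1 ≤ g → ∑ r ∈ Finset.Icc 1 n with g ∣ r, invDivisorSum r ^ 3 / r * g
      ≤ invDivisorSum g ^ 3 * A := by
    intro g hg
    have hg0 : (0 : ℝ) < g := by exact_mod_cast hg
    rw [sum_Icc_filter_dvd n g hg]
    calc _ ≤ ∑ m ∈ Finset.Icc 1 (n / g), invDivisorSum g ^ 3 * (invDivisorSum m ^ 3 / m) := by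
          refine Finset.sum_le_sum fun m hm => ?_
          rw [Finset.mem_Icc] at hm
          have hm0 : (0 : ℝ) < m := by exact_mod_cast hm.1
          have := pow_le_pow_left₀ (hwn _) (invDivisorSum_mul_le g m) 3
          rw [mul_pow] at this
          push_cast
          rw [← mul_div_assoc, div_mul_eq_mul_div, mul_comm (g : ℝ), mul_div_mul_right _ _ hg0.ne']
          gcongr
      _ ≤ invDivisorSum g ^ 3 * A := by
          rw [← Finset.mul_sum]
          have := hwn g
          gcongr
          refine le_trans (Finset.sum_le_sum_of_subset_of_nonneg
            (Finset.Icc_subset_Icc_right (Nat.div_le_self n g)) fun i _ _ => ?_) (h₁ n hn)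
          have := hwn i
          positivity
  calc _ = ∑ j ∈ Finset.Icc 1 n, properLambdaSq j / j
          * ∑ r ∈ Finset.Icc 1 n, invDivisorSum r ^ 3 / r * Nat.gcd j r := by
        simp only [Finset.mul_sum]
        rw [Finset.sum_comm]
        refine Finset.sum_congr rfl fun j _ => Finset.sum_congr rfl fun r _ => ?_
        rw [Nat.gcd_comm]; ring
    _ ≤ ∑ j ∈ Finset.Icc 1 n, 8 * A * (properLambdaSq j * (j.divisors.card : ℝ) / j) := by
        refine Finset.sum_le_sum fun j hj => ?_
        rw [Finset.mem_Icc] at hj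
        by_cases hz : properLambdaSq j = 0
        · simp [hz]
        have hpp := isPrimePow_of_properLambdaSq_ne_zero hz
        have hf := properLambdaSq_nonneg j
        have : ∑ r ∈ Finset.Icc 1 n, invDivisorSum r ^ 3 / r * Nat.gcd j r
            ≤ (j.divisors.card : ℝ) * (8 * A) := by
          calc _ ≤ ∑ r ∈ Finset.Icc 1 n, ∑ g ∈ j.divisors,
                if g ∣ r then invDivisorSum r ^ 3 / r * g else 0 := by
                refine Finset.sum_le_sum fun r _ => ?_
                have hg := gcd_le_sum_divisors (r := j) (j := r) (by omega)
                have := hwn r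
                calc _ ≤ invDivisorSum r ^ 3 / r
                      * ∑ g ∈ j.divisors, (if g ∣ r then (g : ℝ) else 0) := by gcongr
                  _ = _ := by
                    rw [Finset.mul_sum]
                    exact Finset.sum_congr rfl fun g _ => by split_ifs <;> simp
            _ = ∑ g ∈ j.divisors, ∑ r ∈ Finset.Icc 1 n with g ∣ r,
                  invDivisorSum r ^ 3 / r * g := by
                rw [Finset.sum_comm]
                exact Finset.sum_congr rfl fun g _ => (Finset.sum_filter _ _).symm
            _ ≤ ∑ g ∈ j.divisors, 8 * A := by
                refine Finset.sum_le_sum fun g hg => ?_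
                refine (inner g (Nat.pos_of_mem_divisors hg)).trans ?_
                gcongr
                -- `g` divides a prime power, so `w(g)³ ≤ 8` and the sum over `g` costs only the
                -- number of divisors of `j`.
                have h2 : invDivisorSum g ≤ 2 :=
                  (invDivisorSum_le_of_dvd (Nat.dvd_of_mem_divisors hg) (by omega)).trans
                    (invDivisorSum_primePow_le hpp)
                calc _ ≤ (2 : ℝ) ^ 3 := pow_le_pow_left₀ (hwn g) h2 3
                  _ = 8 := by norm_num
            _ = _ := by simp
        calc _ ≤ properLambdaSq j / j * ((j.divisors.card : ℝ) * (8 * A)) := by gcongr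
          _ = _ := by ring
    _ ≤ 8 * A * K₂ := by
        rw [← Finset.mul_sum]
        gcongr
        exact h₂ n
    _ = _ := by rw [hA]; ring

/-! ### Bounds for the coefficient sums over multiples of `r` -/

theorem log_natCast_le_log {N : ℝ} (hN : 1 < N) {d : ℕ} (hd : d ∈ Finset.Icc 1 ⌊N⌋₊) :
    Real.log d ≤ Real.log N := by
  rw [Finset.mem_Icc] at hd
  exact Real.log_le_log (by exact_mod_cast hd.1) ((Nat.le_floor_iff (by linarith)).1 hd.2)

/-- If `s` and `m` share a factor, both sides vanish. Fixing a divisor `s` therefore only enlarges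
the modulus to `s j`. -/
theorem coprimeMoebius_mul (j s m : ℕ) :
    coprimeMoebius j (s * m) = coprimeMoebius j s * coprimeMoebius (s * j) m := by
  rw [coprimeMoebius, coprimeMoebius, coprimeMoebius]
  by_cases h : Nat.Coprime s m
  · rw [isMultiplicative_moebius.map_mul_of_coprime h]
    have : Nat.Coprime m (s * j) ↔ Nat.Coprime m j := by
      rw [Nat.coprime_mul_iff_right]; exact ⟨fun h' => h'.2, fun h' => ⟨h.symm, h'⟩⟩
    simp only [this, Nat.coprime_mul_iff_left]
    split_ifs <;> simp_all
  · rw [moebius_eq_zero_of_not_squarefree (fun hs => h (Nat.coprime_of_squarefree_mul hs))]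
    have : ¬ Nat.Coprime m (s * j) := fun h' => h (Nat.coprime_mul_iff_right.1 h').1.symm
    rw [if_neg this]
    simp

theorem exists_norm_sum_multiples_le (Q : Polynomial ℂ) (hQ : Q.eval 0 = 0) (C : ℝ) (hC : 0 ≤ C) :
    ∃ K : ℝ, 0 ≤ K ∧ ∀ (N : ℝ) (α : ℂ) (j s : ℕ), 1 < N → ‖α‖ * Real.log N ≤ C → 1 ≤ j → 1 ≤ s →
      ‖∑ m ∈ Finset.Icc 1 (⌊N⌋₊ / j) with s ∣ m, (coprimeMoebius j m : ℂ) * shiftedInv α m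
          * polyWeight Q N (j * m)‖ ≤ K * invDivisorSum (s * j) / (s * Real.log N) := by
  obtain ⟨K, hK, h⟩ := exists_norm_mollifier_le Q hQ C hC
  refine ⟨Real.exp C * K, by positivity, fun N α j s hN hα hj hs => ?_⟩
  have hL : 0 < Real.log N := Real.log_pos hN
  have hw := invDivisorSum_nonneg (s * j)
  have hj0 : (0 : ℝ) < j := by exact_mod_cast hj
  have hs0 : (0 : ℝ) < s := by exact_mod_cast hs
  rw [sum_Icc_filter_dvd _ s hs]
  -- For `s > N` the sum is empty. Otherwise `log s ≤ log N`, which is needed to bound `s^(-α)`.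
  rcases Nat.lt_or_ge ⌊N⌋₊ s with hsN | hsN
  · have : ⌊N⌋₊ / j / s = 0 :=
      Nat.div_eq_of_lt ((Nat.div_le_self _ _).trans_lt hsN)
    rw [this]
    simp only [Finset.Icc_eq_empty_of_lt zero_lt_one, Finset.sum_empty, norm_zero]
    positivity
  set x : ℝ := N / (j * s : ℕ) with hx
  have hx0 : 0 < x := by positivity
  have hfl : ⌊N⌋₊ / j / s = ⌊x⌋₊ := by
    rw [hx, Nat.floor_div_natCast, Nat.div_div_eq_div_mul]
  have hterm : ∀ m ∈ Finset.Icc 1 (⌊N⌋₊ / j / s), (coprimeMoebius j (s * m) : ℂ)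
        * shiftedInv α (s * m) * polyWeight Q N (j * (s * m))
      = ((coprimeMoebius j s : ℂ) * shiftedInv α s) * ((coprimeMoebius (s * j) m : ℂ)
          * shiftedInv α m * Q.eval ((Real.log (x / m) / Real.log N : ℝ) : ℂ)) := by
    intro m _
    rw [coprimeMoebius_mul, shiftedInv_mul, polyWeight, hx]
    have : N / ((j * (s * m) : ℕ) : ℝ) = N / (j * s : ℕ) / m := by
      push_cast; rw [div_div, mul_assoc]
    rw [this]
    push_cast
    ring
  rw [Finset.sum_congr rfl hterm, ← Finset.mul_sum, norm_mul, norm_mul, hfl]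
  have hxN : Real.log x ≤ Real.log N := by
    apply Real.log_le_log hx0
    apply div_le_self (by linarith)
    exact_mod_cast Nat.mul_pos hj hs
  have h1 := h (Real.log N) α (s * j) x hL hα (Nat.mul_pos hs hj).ne' hx0 hxN
  have h2 : ‖(coprimeMoebius j s : ℂ)‖ ≤ 1 := by
    rw [Complex.norm_real]; exact abs_coprimeMoebius_le_one j s
  have h3 := norm_shiftedInv_le hs (log_natCast_le_log hN (Finset.mem_Icc.2 ⟨hs, hsN⟩)) hα
  calc _ ≤ 1 * (Real.exp C / s) * (K * invDivisorSum (s * j) / Real.log N) := by gcongr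
    _ = _ := by field_simp

/-- The sum of `x d / d ^ (1 + α)` over the multiples `d ≤ N` of `r`. -/
noncomputable def multiplesSum (N : ℝ) (α : ℂ) (x : ℕ → ℂ) (r : ℕ) : ℂ :=
  ∑ d ∈ Finset.Icc 1 ⌊N⌋₊ with r ∣ d, x d * shiftedInv α d

theorem exists_norm_multiplesSum_moebius_le (Q : Polynomial ℂ) (hQ : Q.eval 0 = 0) (C : ℝ)
    (hC : 0 ≤ C) :
    ∃ K : ℝ, 0 ≤ K ∧ ∀ (N : ℝ) (α : ℂ) (s : ℕ), 1 < N → ‖α‖ * Real.log N ≤ C → 1 ≤ s →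
      ‖multiplesSum N α (fun d => (moebius d : ℂ) * polyWeight Q N d) s‖
        ≤ K * invDivisorSum s / (s * Real.log N) := by
  obtain ⟨K, hK, h⟩ := exists_norm_sum_multiples_le Q hQ C hC
  refine ⟨K, hK, fun N α s hN hα hs => ?_⟩
  have h1 := h N α 1 s hN hα le_rfl hs
  rw [mul_one, Nat.div_one] at h1
  refine le_trans (le_of_eq ?_) h1
  rw [multiplesSum]
  congr 1
  refine Finset.sum_congr rfl fun m _ => ?_
  rw [coprimeMoebius, if_pos (Nat.coprime_one_right m), one_mul]
  push_cast
  ring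

/-- As `log d / log N = 1 - log(N/d)/log N`, the factor `(log d / log N)²` is absorbed in the
polynomial `(1 - X)² P`, which still vanishes at 0. The diagonal primes become an outer sum over
`q`. -/
theorem coeffB_eq (P : Polynomial ℂ) {N : ℝ} (hN : 1 < N) {d : ℕ} (hd : d ∈ Finset.Icc 1 ⌊N⌋₊) :
    coeffB P N d = (moebius d : ℂ) * polyWeight ((1 - Polynomial.X) ^ 2 * P) N d
      - ∑ q ∈ Finset.Icc 1 ⌊N⌋₊, if q ∣ d then
          (((if q.Prime then Real.log q ^ 2 else 0) / Real.log N ^ 2 : ℝ) : ℂ)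
            * ((moebius d : ℂ) * polyWeight P N d) else 0 := by
  have hL : Real.log N ≠ 0 := (Real.log_pos hN).ne'
  rw [Finset.mem_Icc] at hd
  have hd0 : (d : ℝ) ≠ 0 := by exact_mod_cast (by omega : d ≠ 0)
  have h1 : ∑ q ∈ Finset.Icc 1 ⌊N⌋₊, (if q ∣ d then
          (((if q.Prime then Real.log q ^ 2 else 0) / Real.log N ^ 2 : ℝ) : ℂ)
            * ((moebius d : ℂ) * polyWeight P N d) else 0)
      = (((∑ q ∈ d.primeFactors, Real.log q ^ 2) / Real.log N ^ 2 : ℝ) : ℂ)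
            * ((moebius d : ℂ) * polyWeight P N d) := by
    rw [Finset.sum_div, Complex.ofReal_sum, Finset.sum_mul]
    symm
    have hsub : d.primeFactors ⊆ Finset.Icc 1 ⌊N⌋₊ := fun q hq => Finset.mem_Icc.2
      ⟨(Nat.prime_of_mem_primeFactors hq).pos,
        (Nat.le_of_dvd hd.1 (Nat.dvd_of_mem_primeFactors hq)).trans hd.2⟩
    rw [← Finset.sum_subset hsub]
    · refine Finset.sum_congr rfl fun q hq => ?_
      rw [if_pos (Nat.dvd_of_mem_primeFactors hq), if_pos (Nat.prime_of_mem_primeFactors hq)]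
    · intro q _ hq
      split_ifs with h1 h2
      · exact absurd (Nat.mem_primeFactors.2 ⟨h2, h1, by omega⟩) hq
      · simp
      · rfl
  have h2 : polyWeight ((1 - Polynomial.X) ^ 2 * P) N d
      = ((Real.log d ^ 2 / Real.log N ^ 2 : ℝ) : ℂ) * polyWeight P N d := by
    rw [polyWeight, polyWeight, Polynomial.eval_mul]
    congr 1
    have : (1 : ℝ) - Real.log (N / d) / Real.log N = Real.log d / Real.log N := by
      rw [Real.log_div (by linarith) hd0]; field_simp; ring
    simp only [Polynomial.eval_pow, Polynomial.eval_sub, Polynomial.eval_one, Polynomial.eval_X]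
    rw [← Complex.ofReal_one, ← Complex.ofReal_sub, this, ← div_pow, Complex.ofReal_pow]
  have h3 := congrArg (fun t : ℝ => (t : ℂ)) (moebius_mul_sum_offDiag d)
  push_cast at h3
  rw [h1, h2, coeffB, primePairSum, ← Finset.sum_div]
  push_cast
  linear_combination (polyWeight P N d / (Real.log N : ℂ) ^ 2) * h3

theorem exists_norm_multiplesSum_coeffB_le (P : Polynomial ℂ) (hP : P.eval 0 = 0) (C : ℝ)
    (hC : 0 ≤ C) :
    ∃ K : ℝ, 0 ≤ K ∧ ∀ (N : ℝ) (α : ℂ) (r : ℕ), 1 < N → ‖α‖ * Real.log N ≤ C →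
      r ∈ Finset.Icc 1 ⌊N⌋₊ →
      ‖multiplesSum N α (coeffB P N) r‖ ≤ K * invDivisorSum r / (r * Real.log N) := by
  obtain ⟨K₁, hK₁, h₁⟩ := exists_norm_multiplesSum_moebius_le ((1 - Polynomial.X) ^ 2 * P)
    (by simp [hP]) C hC
  obtain ⟨K₂, hK₂, h₂⟩ := exists_norm_multiplesSum_moebius_le P hP C hC
  refine ⟨K₁ + 8 * K₂, by positivity, fun N α r hN hα hr => ?_⟩
  have hlogn : Real.log ⌊N⌋₊ ≤ Real.log N :=
    log_natCast_le_log hN (Finset.right_mem_Icc.2 ((Nat.one_le_floor_iff N).2 hN.le))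
  rw [Finset.mem_Icc] at hr
  have hL : 0 < Real.log N := Real.log_pos hN
  have hr0 : (0 : ℝ) < r := by exact_mod_cast hr.1
  have hw := invDivisorSum_nonneg r
  set v : ℕ → ℝ := fun q => (if q.Prime then Real.log q ^ 2 else 0) / Real.log N ^ 2 with hv
  have hv0 : ∀ q, 0 ≤ v q := fun q => by
    simp only [hv]; split_ifs <;> positivity
  have hvle : ∀ q, v q ≤ vonMangoldt q ^ 2 / Real.log N ^ 2 := fun q => by
    simp only [hv]
    gcongr
    split_ifs with h
    · rw [vonMangoldt_apply_prime h]
    · positivity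
  -- The conditions `r ∣ d` and `q ∣ d` together mean that the least common multiple divides `d`;
  -- since `1/[r,q] = (r,q)/(rq)`, the sum over `q` carries the gcd weight bounded above.
  have key : multiplesSum N α (coeffB P N) r
      = multiplesSum N α (fun d => (moebius d : ℂ) * polyWeight ((1 - Polynomial.X) ^ 2 * P) N d) r
        - ∑ q ∈ Finset.Icc 1 ⌊N⌋₊, (v q : ℂ)
          * multiplesSum N α (fun d => (moebius d : ℂ) * polyWeight P N d) (Nat.lcm r q) := by
    have e : ∀ q, (v q : ℂ)
          * multiplesSum N α (fun d => (moebius d : ℂ) * polyWeight P N d) (Nat.lcm r q)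
        = ∑ d ∈ Finset.Icc 1 ⌊N⌋₊ with r ∣ d, (if q ∣ d then
          (v q : ℂ) * ((moebius d : ℂ) * polyWeight P N d) else 0) * shiftedInv α d := by
      intro q
      rw [multiplesSum, Finset.mul_sum]
      simp only [ite_mul, zero_mul]
      rw [← Finset.sum_filter, Finset.filter_filter]
      refine Finset.sum_congr ?_ fun d _ => by ring
      ext d
      simp only [Finset.mem_filter, Nat.lcm_dvd_iff]
    simp only [e]
    rw [Finset.sum_comm, multiplesSum, multiplesSum, ← Finset.sum_sub_distrib]
    refine Finset.sum_congr rfl fun d hd => ?_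
    rw [coeffB_eq P hN (Finset.mem_filter.1 hd).1, sub_mul, Finset.sum_mul]
  rw [key]
  refine (norm_sub_le _ _).trans ?_
  have b1 := h₁ N α r hN hα hr.1
  have b2 : ‖∑ q ∈ Finset.Icc 1 ⌊N⌋₊, (v q : ℂ)
      * multiplesSum N α (fun d => (moebius d : ℂ) * polyWeight P N d) (Nat.lcm r q)‖
      ≤ 8 * K₂ * invDivisorSum r / (r * Real.log N) := by
    calc _ ≤ ∑ q ∈ Finset.Icc 1 ⌊N⌋₊, 2 * K₂ * invDivisorSum r / (r * Real.log N)
          / Real.log N ^ 2 * (vonMangoldt q ^ 2 * (Nat.gcd r q / q)) := by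
          refine norm_sum_le_of_le _ fun q hq => ?_
          rw [Finset.mem_Icc] at hq
          rw [norm_mul, Complex.norm_real, Real.norm_eq_abs, abs_of_nonneg (hv0 q)]
          by_cases hp : q.Prime
          · have hq0 : (0 : ℝ) < q := by exact_mod_cast hq.1
            have hl : 1 ≤ Nat.lcm r q := Nat.lcm_pos hr.1 hq.1
            have hl0 : (0 : ℝ) < Nat.lcm r q := by exact_mod_cast hl
            have a1 := h₂ N α (Nat.lcm r q) hN hα hl
            have a2 : invDivisorSum (Nat.lcm r q) ≤ invDivisorSum r * 2 :=
              (invDivisorSum_le_of_dvd (Nat.lcm_dvd_mul r q)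
                (Nat.mul_pos hr.1 hq.1).ne').trans ((invDivisorSum_mul_le r q).trans
                (mul_le_mul_of_nonneg_left (invDivisorSum_primePow_le hp.isPrimePow) hw))
            have a3 : ((Nat.lcm r q : ℕ) : ℝ)⁻¹ = Nat.gcd r q / (r * q) := by
              have := Nat.gcd_mul_lcm r q
              have h' : ((Nat.gcd r q : ℕ) : ℝ) * (Nat.lcm r q : ℕ) = r * q := by
                exact_mod_cast this
              field_simp
              linarith
            calc _ ≤ vonMangoldt q ^ 2 / Real.log N ^ 2
                  * (K₂ * (invDivisorSum r * 2) / (Nat.lcm r q * Real.log N)) := by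
                  gcongr
                  · exact hvle q
                  · exact a1.trans (by gcongr)
              _ = vonMangoldt q ^ 2 / Real.log N ^ 2
                  * (K₂ * (invDivisorSum r * 2) * ((Nat.lcm r q : ℕ) : ℝ)⁻¹ / Real.log N) := by
                  field_simp
              _ = _ := by rw [a3]; field_simp
          · have : v q = 0 := by simp [hv, hp]
            rw [this, zero_mul]
            positivity
      -- The `8` is the `2` bounding `w(q)` times the `4` of the gcd-weighted von Mangoldt bound.
      _ ≤ 2 * K₂ * invDivisorSum r / (r * Real.log N)
          / Real.log N ^ 2 * (4 * Real.log N ^ 2) := by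
          rw [← Finset.mul_sum]
          gcongr
          refine (sum_vonMangoldt_sq_gcd_le hr.1 hr.2).trans ?_
          have := Real.log_natCast_nonneg ⌊N⌋₊
          gcongr
      _ = _ := by field_simp; ring
  calc _ ≤ K₁ * invDivisorSum r / (r * Real.log N)
        + 8 * K₂ * invDivisorSum r / (r * Real.log N) := add_le_add b1 b2
    _ = _ := by ring

theorem dvd_mul_iff_div_gcd_dvd {r j : ℕ} (hr : 1 ≤ r) (m : ℕ) :
    r ∣ j * m ↔ r / Nat.gcd r j ∣ m := by
  rw [Nat.div_dvd_iff_dvd_mul (Nat.gcd_dvd_left r j) (Nat.gcd_pos_of_pos_left j hr)]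
  exact (Nat.dvd_gcd_mul_iff_dvd_mul).symm

theorem multiplesSum_coeffC_eq (P : Polynomial ℂ) (N : ℝ) (α : ℂ) {r : ℕ} (hr : 1 ≤ r) :
    multiplesSum N α (coeffC P N) r
      = ∑ j ∈ Finset.Icc 1 ⌊N⌋₊, ((properLambdaSq j / Real.log N ^ 2 : ℝ) : ℂ) * shiftedInv α j
        * ∑ m ∈ Finset.Icc 1 (⌊N⌋₊ / j) with r / Nat.gcd r j ∣ m,
          (coprimeMoebius j m : ℂ) * shiftedInv α m * polyWeight P N (j * m) := by
  have h1 : multiplesSum N α (coeffC P N) r = ∑ d ∈ Finset.Icc 1 ⌊N⌋₊, ∑ j ∈ d.divisors,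
      if r ∣ d then ((properLambdaSq j / Real.log N ^ 2 : ℝ) : ℂ) * (coprimeMoebius j (d / j) : ℂ)
        * polyWeight P N d * shiftedInv α d else 0 := by
    rw [multiplesSum, Finset.sum_filter]
    refine Finset.sum_congr rfl fun d hd => ?_
    rw [Finset.mem_Icc] at hd
    split_ifs with h
    · rw [coeffC_eq, nonsquarefreePart_eq_sum (by omega), Finset.sum_div, Complex.ofReal_sum,
        Finset.sum_mul, Finset.sum_mul]
      refine Finset.sum_congr rfl fun j _ => ?_
      rw [coprimeMoebius]
      simp only [Nat.coprime_comm]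
      split_ifs <;> push_cast <;> ring
    · simp
  rw [h1, sum_Icc_sum_divisors' ⌊N⌋₊ (fun j d => if r ∣ d then
      ((properLambdaSq j / Real.log N ^ 2 : ℝ) : ℂ) * (coprimeMoebius j (d / j) : ℂ)
        * polyWeight P N d * shiftedInv α d else 0)]
  refine Finset.sum_congr rfl fun j hj => ?_
  rw [Finset.mem_Icc] at hj
  rw [Finset.mul_sum, Finset.sum_filter]
  refine Finset.sum_congr rfl fun m _ => ?_
  simp only [dvd_mul_iff_div_gcd_dvd hr]
  rw [Nat.mul_div_cancel_left m hj.1, shiftedInv_mul]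
  split_ifs
  · ring
  · rfl

/-- For fixed `j`, the inner sum runs over multiples of `s = r/(r,j)`, so its bound carries `1/s =
(r,j)/r`. The factor 2 bounds `w(j)` at a prime power. The gcd weight is kept because the gain
appears only on averaging over `r`. -/
theorem exists_norm_multiplesSum_coeffC_le (P : Polynomial ℂ) (hP : P.eval 0 = 0) (C : ℝ)
    (hC : 0 ≤ C) :
    ∃ K : ℝ, 0 ≤ K ∧ ∀ (N : ℝ) (α : ℂ) (r : ℕ), 1 < N → ‖α‖ * Real.log N ≤ C →
      r ∈ Finset.Icc 1 ⌊N⌋₊ →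
      ‖multiplesSum N α (coeffC P N) r‖ ≤ K * invDivisorSum r / (r * Real.log N ^ 3)
        * ∑ j ∈ Finset.Icc 1 ⌊N⌋₊, properLambdaSq j * (Nat.gcd r j / j) := by
  obtain ⟨K, hK, h⟩ := exists_norm_sum_multiples_le P hP C hC
  refine ⟨2 * Real.exp C * K, by positivity, fun N α r hN hα hr => ?_⟩
  rw [Finset.mem_Icc] at hr
  have hL : 0 < Real.log N := Real.log_pos hN
  have hr0 : (0 : ℝ) < r := by exact_mod_cast hr.1
  have hw := invDivisorSum_nonneg r
  rw [multiplesSum_coeffC_eq P N α hr.1, Finset.mul_sum]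
  refine norm_sum_le_of_le _ fun j hj => ?_
  have hjN := log_natCast_le_log hN hj
  rw [Finset.mem_Icc] at hj
  by_cases hz : properLambdaSq j = 0
  · rw [hz]; simp
  have hpp := isPrimePow_of_properLambdaSq_ne_zero hz
  have hf := properLambdaSq_nonneg j
  have hj0 : (0 : ℝ) < j := by exact_mod_cast hj.1
  have hg := Nat.gcd_pos_of_pos_left j hr.1
  have hg0 : (0 : ℝ) < Nat.gcd r j := by exact_mod_cast hg
  have hs : 1 ≤ r / Nat.gcd r j := Nat.div_pos (Nat.gcd_le_left j hr.1) hg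
  have hs' : ((r / Nat.gcd r j : ℕ) : ℝ) = r / Nat.gcd r j :=
    Nat.cast_div (Nat.gcd_dvd_left r j) hg0.ne'
  have a1 := h N α j _ hN hα hj.1 hs
  have a2 : invDivisorSum (r / Nat.gcd r j * j) ≤ invDivisorSum r * 2 :=
    (invDivisorSum_mul_le _ j).trans (mul_le_mul
      (invDivisorSum_le_of_dvd (Nat.div_dvd_of_dvd (Nat.gcd_dvd_left r j)) (by omega))
      (invDivisorSum_primePow_le hpp) (invDivisorSum_nonneg j) hw)
  have a3 := norm_shiftedInv_le hj.1 hjN hα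
  rw [norm_mul, norm_mul, Complex.norm_real, Real.norm_eq_abs, abs_of_nonneg (by positivity)]
  calc _ ≤ properLambdaSq j / Real.log N ^ 2 * (Real.exp C / j)
        * (K * (invDivisorSum r * 2) / ((r / Nat.gcd r j : ℕ) * Real.log N)) := by
        gcongr
        exact a1.trans (by gcongr)
    _ = _ := by rw [hs']; field_simp

/-- A pointwise bound of the same shape as the one for `coeffB`, so that `c` can take the place of
`b` in the product of `c` with itself. -/
theorem exists_norm_multiplesSum_coeffC_le' (P : Polynomial ℂ) (hP : P.eval 0 = 0) (C : ℝ)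
    (hC : 0 ≤ C) :
    ∃ K : ℝ, 0 ≤ K ∧ ∀ (N : ℝ) (α : ℂ) (r : ℕ), 1 < N → ‖α‖ * Real.log N ≤ C →
      r ∈ Finset.Icc 1 ⌊N⌋₊ →
      ‖multiplesSum N α (coeffC P N) r‖ ≤ K * invDivisorSum r / (r * Real.log N) := by
  obtain ⟨K, hK, h⟩ := exists_norm_multiplesSum_coeffC_le P hP C hC
  refine ⟨4 * K, by positivity, fun N α r hN hα hr => (h N α r hN hα hr).trans ?_⟩
  have hlogn : Real.log ⌊N⌋₊ ≤ Real.log N :=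
    log_natCast_le_log hN (Finset.right_mem_Icc.2 ((Nat.one_le_floor_iff N).2 hN.le))
  have hn := Real.log_natCast_nonneg ⌊N⌋₊
  rw [Finset.mem_Icc] at hr
  have hL : 0 < Real.log N := Real.log_pos hN
  have hr0 : (0 : ℝ) < r := by exact_mod_cast hr.1
  have hw := invDivisorSum_nonneg r
  calc _ ≤ K * invDivisorSum r / (r * Real.log N ^ 3) * (4 * Real.log N ^ 2) := by
        gcongr
        refine le_trans (Finset.sum_le_sum fun j _ => ?_)
          ((sum_vonMangoldt_sq_gcd_le hr.1 hr.2).trans (by gcongr))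
        exact mul_le_mul_of_nonneg_right (properLambdaSq_le j) (by positivity)
    _ = _ := by field_simp

/-! ### Diagonalisation of the double sum -/

/-- The Dirichlet convolution of the Möbius function with `n ↦ n ^ (1 + s)`. -/
noncomputable def jordanCoeff (s : ℂ) (r : ℕ) : ℂ :=
  ∑ x ∈ r.divisorsAntidiagonal, (moebius x.1 : ℂ) * (x.2 : ℂ) ^ (1 + s)

theorem sum_divisors_jordanCoeff (s : ℂ) {g : ℕ} (hg : 1 ≤ g) :
    ∑ r ∈ g.divisors, jordanCoeff s r = (g : ℂ) ^ (1 + s) :=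
  (sum_eq_iff_sum_mul_moebius_eq (f := jordanCoeff s) (g := fun n : ℕ => (n : ℂ) ^ (1 + s))).2
    (fun _ _ => rfl) g hg

theorem norm_jordanCoeff_le {s : ℂ} {r : ℕ} {L C : ℝ} (hr : 1 ≤ r) (hrL : Real.log r ≤ L)
    (hs : ‖s‖ * L ≤ C) : ‖jordanCoeff s r‖ ≤ Real.exp C * (r * invDivisorSum r) := by
  have h1 : ∀ x ∈ r.divisorsAntidiagonal, ‖(moebius x.1 : ℂ) * (x.2 : ℂ) ^ (1 + s)‖
      ≤ Real.exp C * (r * (x.1 : ℝ)⁻¹) := by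
    intro x hx
    obtain ⟨hx1, -⟩ := Nat.mem_divisorsAntidiagonal.1 hx
    have p1 : 0 < x.1 := Nat.pos_of_mul_pos_right (hx1 ▸ hr)
    have p2 : 0 < x.2 := Nat.pos_of_mul_pos_left (hx1 ▸ hr)
    have p1' : (0 : ℝ) < x.1 := by exact_mod_cast p1
    have p2' : (x.2 : ℂ) ≠ 0 := by exact_mod_cast p2.ne'
    have hle : x.2 ≤ r := hx1 ▸ Nat.le_mul_of_pos_left _ p1
    have b1 : ‖(x.2 : ℂ) ^ s‖ ≤ Real.exp C := norm_natCast_cpow_le p2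
      ((Real.log_le_log (by exact_mod_cast p2) (by exact_mod_cast hle)).trans hrL) hs
    have b2 : ‖(moebius x.1 : ℂ)‖ ≤ 1 := by
      rw [Complex.norm_intCast]; exact_mod_cast abs_moebius_le_one
    have b3 : (r : ℝ) * (x.1 : ℝ)⁻¹ = x.2 := by rw [← hx1]; push_cast; field_simp
    rw [norm_mul, Complex.cpow_add _ _ p2', Complex.cpow_one, norm_mul, Complex.norm_natCast, b3]
    calc _ ≤ 1 * ((x.2 : ℝ) * Real.exp C) := by gcongr
      _ = _ := by ring
  refine (norm_sum_le_of_le _ h1).trans (le_of_eq ?_)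
  rw [Nat.sum_divisorsAntidiagonal (f := fun a _ => Real.exp C * ((r : ℝ) * (a : ℝ)⁻¹)),
    ← Finset.mul_sum, ← Finset.mul_sum, invDivisorSum]

theorem double_sum_eq (N : ℝ) (α β : ℂ) (x y : ℕ → ℂ) :
    ∑ d ∈ Finset.Icc 1 ⌊N⌋₊, ∑ e ∈ Finset.Icc 1 ⌊N⌋₊, x d * y e / (Nat.lcm d e : ℂ) *
        ((Nat.gcd d e : ℂ) ^ (α + β) / ((d : ℂ) ^ α * (e : ℂ) ^ β))
      = ∑ r ∈ Finset.Icc 1 ⌊N⌋₊, jordanCoeff (α + β) r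
          * (multiplesSum N α x r * multiplesSum N β y r) := by
  have h1 : ∀ d ∈ Finset.Icc 1 ⌊N⌋₊, ∀ e ∈ Finset.Icc 1 ⌊N⌋₊, x d * y e / (Nat.lcm d e : ℂ) *
        ((Nat.gcd d e : ℂ) ^ (α + β) / ((d : ℂ) ^ α * (e : ℂ) ^ β))
      = ∑ r ∈ Finset.Icc 1 ⌊N⌋₊, jordanCoeff (α + β) r
          * ((if r ∣ d then x d * shiftedInv α d else 0)
            * (if r ∣ e then y e * shiftedInv β e else 0)) := by
    intro d hd e he
    rw [Finset.mem_Icc] at hd he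
    have hg : 1 ≤ Nat.gcd d e := Nat.gcd_pos_of_pos_left e hd.1
    have hg0 : (Nat.gcd d e : ℂ) ≠ 0 := by exact_mod_cast (by omega : Nat.gcd d e ≠ 0)
    have hd0 : (d : ℂ) ≠ 0 := by exact_mod_cast (by omega : d ≠ 0)
    have he0 : (e : ℂ) ≠ 0 := by exact_mod_cast (by omega : e ≠ 0)
    have hl0 : (Nat.lcm d e : ℂ) ≠ 0 := by
      exact_mod_cast (Nat.lcm_pos hd.1 he.1).ne'
    have h2 : ∑ r ∈ Finset.Icc 1 ⌊N⌋₊, jordanCoeff (α + β) r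
          * ((if r ∣ d then x d * shiftedInv α d else 0)
            * (if r ∣ e then y e * shiftedInv β e else 0))
        = (∑ r ∈ (Nat.gcd d e).divisors, jordanCoeff (α + β) r)
          * (x d * shiftedInv α d * (y e * shiftedInv β e)) := by
      rw [Finset.sum_mul]
      symm
      have hsub : (Nat.gcd d e).divisors ⊆ Finset.Icc 1 ⌊N⌋₊ := fun r hr => Finset.mem_Icc.2
        ⟨Nat.pos_of_mem_divisors hr, (Nat.le_of_dvd hg (Nat.dvd_of_mem_divisors hr)).trans
          ((Nat.gcd_le_left e hd.1).trans hd.2)⟩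
      rw [← Finset.sum_subset hsub]
      · refine Finset.sum_congr rfl fun r hr => ?_
        have hr' := Nat.dvd_gcd_iff.1 (Nat.dvd_of_mem_divisors hr)
        rw [if_pos hr'.1, if_pos hr'.2]
      · intro r _ hr
        split_ifs with h h'
        · exact absurd (Nat.mem_divisors.2 ⟨Nat.dvd_gcd h h', by omega⟩) hr
        all_goals simp
    have h3 : (Nat.gcd d e : ℂ) * Nat.lcm d e = d * e := by
      exact_mod_cast Nat.gcd_mul_lcm d e
    have hdα : (d : ℂ) ^ α ≠ 0 := by rw [Complex.cpow_ne_zero_iff]; exact Or.inl hd0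
    have heβ : (e : ℂ) ^ β ≠ 0 := by rw [Complex.cpow_ne_zero_iff]; exact Or.inl he0
    rw [h2, sum_divisors_jordanCoeff _ hg, shiftedInv, shiftedInv, Complex.cpow_neg,
      Complex.cpow_neg, Complex.cpow_add 1 _ hg0, Complex.cpow_one]
    field_simp
    linear_combination (-(x d * y e * (Nat.gcd d e : ℂ) ^ (α + β))) * h3
  rw [Finset.sum_congr rfl fun d hd => Finset.sum_congr rfl (h1 d hd)]
  have h4 : ∀ r, jordanCoeff (α + β) r * (multiplesSum N α x r * multiplesSum N β y r)
      = ∑ d ∈ Finset.Icc 1 ⌊N⌋₊, ∑ e ∈ Finset.Icc 1 ⌊N⌋₊, jordanCoeff (α + β) r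
          * ((if r ∣ d then x d * shiftedInv α d else 0)
            * (if r ∣ e then y e * shiftedInv β e else 0)) := by
    intro r
    rw [multiplesSum, multiplesSum, Finset.sum_filter, Finset.sum_filter, Finset.sum_mul_sum,
      Finset.mul_sum]
    exact Finset.sum_congr rfl fun d _ => Finset.mul_sum _ _ _
  simp only [h4]
  rw [Finset.sum_comm (s := Finset.Icc 1 ⌊N⌋₊) (t := Finset.Icc 1 ⌊N⌋₊)
    (f := fun r d => ∑ e ∈ Finset.Icc 1 ⌊N⌋₊, jordanCoeff (α + β) r
          * ((if r ∣ d then x d * shiftedInv α d else 0)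
            * (if r ∣ e then y e * shiftedInv β e else 0)))]
  exact Finset.sum_congr rfl fun d _ => Finset.sum_comm

/-- The `r`-th term is at most a constant times `w(r)³/(r L⁴)` times the gcd-weighted sum over
proper prime powers. Averaging over `r` returns one factor `L`. -/
theorem exists_norm_diagonal_sum_le (C K₁ K₂ : ℝ) (hK₁ : 0 ≤ K₁) (hK₂ : 0 ≤ K₂) :
    ∃ K : ℝ, 0 ≤ K ∧ ∀ (N : ℝ) (s : ℂ) (X Y : ℕ → ℂ), 1 ≤ Real.log N → 1 < N →
      ‖s‖ * Real.log N ≤ C →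
      (∀ r ∈ Finset.Icc 1 ⌊N⌋₊, ‖X r‖ ≤ K₁ * invDivisorSum r / (r * Real.log N)) →
      (∀ r ∈ Finset.Icc 1 ⌊N⌋₊, ‖Y r‖ ≤ K₂ * invDivisorSum r / (r * Real.log N ^ 3)
        * ∑ j ∈ Finset.Icc 1 ⌊N⌋₊, properLambdaSq j * (Nat.gcd r j / j)) →
      ‖∑ r ∈ Finset.Icc 1 ⌊N⌋₊, jordanCoeff s r * (X r * Y r)‖ ≤ K / Real.log N ^ 3 := by
  obtain ⟨K₃, hK₃, h₃⟩ := exists_sum_invDivisorSum_properLambdaSq_le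
  refine ⟨2 * (Real.exp C * K₁ * K₂) * K₃, by positivity, fun N s X Y hL hN hs hX hY => ?_⟩
  have hN1 : 1 ≤ ⌊N⌋₊ := (Nat.one_le_floor_iff N).2 hN.le
  have hlogn : Real.log ⌊N⌋₊ ≤ Real.log N := log_natCast_le_log hN (Finset.right_mem_Icc.2 hN1)
  have hL0 : 0 < Real.log N := by linarith
  calc _ ≤ ∑ r ∈ Finset.Icc 1 ⌊N⌋₊, Real.exp C * K₁ * K₂ / Real.log N ^ 4
        * (invDivisorSum r ^ 3 / r
          * ∑ j ∈ Finset.Icc 1 ⌊N⌋₊, properLambdaSq j * (Nat.gcd r j / j)) := by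
        refine norm_sum_le_of_le _ fun r hr => ?_
        have a1 := hX r hr
        have a2 := hY r hr
        have a3 := log_natCast_le_log hN hr
        rw [Finset.mem_Icc] at hr
        have hr0 : (0 : ℝ) < r := by exact_mod_cast hr.1
        have hw := invDivisorSum_nonneg r
        have a4 := norm_jordanCoeff_le hr.1 a3 hs
        rw [norm_mul, norm_mul]
        calc _ ≤ Real.exp C * (r * invDivisorSum r)
              * (K₁ * invDivisorSum r / (r * Real.log N)
                * (K₂ * invDivisorSum r / (r * Real.log N ^ 3)
        * ∑ j ∈ Finset.Icc 1 ⌊N⌋₊, properLambdaSq j * (Nat.gcd r j / j))) := by gcongr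
          _ = _ := by field_simp
    _ ≤ Real.exp C * K₁ * K₂ / Real.log N ^ 4 * (K₃ * (2 * Real.log N)) := by
        rw [← Finset.mul_sum]
        gcongr
        refine (h₃ _ hN1).trans ?_
        gcongr
        linarith
    _ = _ := by field_simp

/-! ### The zeta factor and the conclusion -/

/-- The residue at the simple pole is 1, so `‖s ζ(1+s)‖` is below 2 near `s = 0`. -/
theorem exists_norm_zeta_le : ∃ δ : ℝ, 0 < δ ∧ ∀ s : ℂ, 0 < ‖s‖ → ‖s‖ < δ →
    ‖riemannZeta (1 + s)‖ ≤ 2 / ‖s‖ := by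
  have h := riemannZeta_residue_one.norm.eventually_le_const
    (show ‖(1 : ℂ)‖ < 2 by rw [norm_one]; norm_num)
  rw [eventually_nhdsWithin_iff, Metric.eventually_nhds_iff] at h
  obtain ⟨δ, hδ, h⟩ := h
  refine ⟨δ, hδ, fun s hs0 hs => ?_⟩
  have h1 := h (y := 1 + s) (by rwa [dist_eq_norm, add_sub_cancel_left])
    (by
      intro h'
      rw [Set.mem_singleton_iff, add_eq_left] at h'
      rw [h', norm_zero] at hs0
      exact lt_irrefl _ hs0)
  rw [add_sub_cancel_left, norm_mul] at h1
  rw [le_div_iff₀ hs0]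
  linarith

theorem mainTerm_add_left (Φ : ℝ → ℂ) (T N : ℝ) (α β : ℂ) (x x' y : ℕ → ℂ) :
    mainTerm Φ T N α β (x + x') y = mainTerm Φ T N α β x y + mainTerm Φ T N α β x' y := by
  simp only [mainTerm]
  rw [← mul_add, ← Finset.sum_add_distrib]
  congr 1
  refine Finset.sum_congr rfl fun d _ => ?_
  rw [← Finset.sum_add_distrib]
  refine Finset.sum_congr rfl fun e _ => ?_
  rw [Pi.add_apply]; ring

theorem mainTerm_add_right (Φ : ℝ → ℂ) (T N : ℝ) (α β : ℂ) (x y y' : ℕ → ℂ) :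
    mainTerm Φ T N α β x (y + y') = mainTerm Φ T N α β x y + mainTerm Φ T N α β x y' := by
  simp only [mainTerm]
  rw [← mul_add, ← Finset.sum_add_distrib]
  congr 1
  refine Finset.sum_congr rfl fun d _ => ?_
  rw [← Finset.sum_add_distrib]
  refine Finset.sum_congr rfl fun e _ => ?_
  rw [Pi.add_apply]; ring

theorem coeffA_eq_add (P : Polynomial ℂ) (N : ℝ) : coeffA P N = coeffB P N + coeffC P N := by
  funext n
  rw [Pi.add_apply, coeffC]; ring

theorem exists_norm_multiplesSum_products_le (P : Polynomial ℂ) (hP : P.eval 0 = 0) (C : ℝ)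
    (hC : 0 ≤ C) :
    ∃ K : ℝ, 0 ≤ K ∧ ∀ (N : ℝ) (α β : ℂ), 1 ≤ Real.log N → 1 < N → ‖α‖ * Real.log N ≤ C →
      ‖β‖ * Real.log N ≤ C → ∀ x y, (x = coeffB P N ∧ y = coeffC P N) ∨
        (x = coeffC P N ∧ y = coeffB P N) ∨ (x = coeffC P N ∧ y = coeffC P N) →
      ‖∑ r ∈ Finset.Icc 1 ⌊N⌋₊, jordanCoeff (α + β) r
          * (multiplesSum N α x r * multiplesSum N β y r)‖ ≤ K / Real.log N ^ 3 := by
  obtain ⟨K₁, hK₁, h₁⟩ := exists_norm_multiplesSum_coeffB_le P hP C hC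
  obtain ⟨K₂, hK₂, h₂⟩ := exists_norm_multiplesSum_coeffC_le P hP C hC
  obtain ⟨K₃, hK₃, h₃⟩ := exists_norm_multiplesSum_coeffC_le' P hP C hC
  obtain ⟨K₄, hK₄, h₄⟩ := exists_norm_diagonal_sum_le (2 * C) K₁ K₂ hK₁ hK₂
  obtain ⟨K₅, hK₅, h₅⟩ := exists_norm_diagonal_sum_le (2 * C) K₃ K₂ hK₃ hK₂
  refine ⟨K₄ + K₅, by positivity, fun N α β hL hN hα hβ x y hxy => ?_⟩
  have hs : ‖α + β‖ * Real.log N ≤ 2 * C := by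
    have := mul_le_mul_of_nonneg_right (norm_add_le α β) (show 0 ≤ Real.log N by linarith)
    linarith
  have l4 : K₄ / Real.log N ^ 3 ≤ (K₄ + K₅) / Real.log N ^ 3 := by gcongr; linarith
  have l5 : K₅ / Real.log N ^ 3 ≤ (K₄ + K₅) / Real.log N ^ 3 := by gcongr; linarith
  rcases hxy with ⟨rfl, rfl⟩ | ⟨rfl, rfl⟩ | ⟨rfl, rfl⟩
  · exact (h₄ N _ _ _ hL hN hs (fun r hr => h₁ N α r hN hα hr)
      (fun r hr => h₂ N β r hN hβ hr)).trans l4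
  · simp only [mul_comm (multiplesSum N α _ _)]
    exact (h₄ N _ _ _ hL hN hs (fun r hr => h₁ N β r hN hβ hr)
      (fun r hr => h₂ N α r hN hα hr)).trans l4
  · exact (h₅ N _ _ _ hL hN hs (fun r hr => h₃ N α r hN hα hr)
      (fun r hr => h₂ N β r hN hβ hr)).trans l5

/-- The main terms involving `coeffC` are `O(T / (log N) ^ 2)`. -/
theorem exists_norm_mainTerm_le (P : Polynomial ℂ) (hP : P.eval 0 = 0) {θ : ℝ} (hθ : 0 < θ)
    (hθ1 : θ < 1) (Φ : ℝ → ℂ) {c₀ C₀ : ℝ} (hc₀ : 0 < c₀) (hC₀ : 0 < C₀) :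
    ∃ K T₀ : ℝ, 0 ≤ K ∧ 1 ≤ T₀ ∧ ∀ T : ℝ, T₀ ≤ T → ∀ α β : ℂ, ‖α‖ ≤ C₀ / Real.log T →
      ‖β‖ ≤ C₀ / Real.log T → c₀ / Real.log T ≤ ‖α + β‖ →
      ∀ x y, (x = coeffB P (T ^ θ) ∧ y = coeffC P (T ^ θ)) ∨
        (x = coeffC P (T ^ θ) ∧ y = coeffB P (T ^ θ)) ∨
        (x = coeffC P (T ^ θ) ∧ y = coeffC P (T ^ θ)) →
      ‖mainTerm Φ T (T ^ θ) α β x y‖ ≤ K * (T / Real.log (T ^ θ) ^ 2) := by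
  obtain ⟨K, hK, h⟩ := exists_norm_multiplesSum_products_le P hP C₀ hC₀.le
  obtain ⟨δ, hδ, hζ⟩ := exists_norm_zeta_le
  -- In the threshold, `1/θ` forces `log N ≥ 1`, and `2C₀/δ` brings `α + β` within `δ` of the pole.
  -- The factor `2/(c₀θ)` comes from `2/‖α+β‖ ≤ 2 log T / c₀` with `log T = log N / θ`.
  refine ⟨‖FourierTransform.fourier Φ 0‖ * (2 / (c₀ * θ)) * K,
    Real.exp (1 / θ + 2 * C₀ / δ), by positivity, Real.one_le_exp (by positivity), ?_⟩
  intro T hT α β hα hβ hαβ x y hxy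
  have hT0 : 0 < T := (Real.exp_pos _).trans_le hT
  have hlT : 1 / θ + 2 * C₀ / δ ≤ Real.log T := (Real.le_log_iff_exp_le hT0).2 hT
  have hθ' : 0 < 1 / θ := by positivity
  have hδ' : 0 < 2 * C₀ / δ := by positivity
  have hlT0 : 0 < Real.log T := by linarith
  set N := T ^ θ with hN
  have hlN : Real.log N = θ * Real.log T := Real.log_rpow hT0 θ
  have hL1 : 1 ≤ Real.log N := by
    rw [hlN]
    calc (1 : ℝ) = θ * (1 / θ) := by field_simp
      _ ≤ θ * Real.log T := by gcongr; linarith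
  have hL0 : 0 < Real.log N := by linarith
  have hN1 : 1 < N := by
    by_contra hc
    have := Real.log_nonpos (Real.rpow_nonneg hT0.le θ) (not_lt.1 hc)
    linarith
  have hsc : ∀ z : ℂ, ‖z‖ ≤ C₀ / Real.log T → ‖z‖ * Real.log N ≤ C₀ := by
    intro z hz
    calc ‖z‖ * Real.log N ≤ C₀ / Real.log T * Real.log N := by gcongr
      _ = C₀ * θ := by rw [hlN]; field_simp
      _ ≤ C₀ * 1 := by gcongr
      _ = C₀ := mul_one _
  have hs0 : 0 < ‖α + β‖ := lt_of_lt_of_le (by positivity) hαβ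
  have hsδ : ‖α + β‖ < δ := by
    have h1 : ‖α + β‖ ≤ 2 * C₀ / Real.log T := by
      have := norm_add_le α β
      rw [mul_div_assoc]; linarith
    refine h1.trans_lt ?_
    rw [div_lt_iff₀ hlT0, ← div_lt_iff₀' hδ]
    linarith
  have hz : ‖riemannZeta (1 + α + β)‖ ≤ 2 / (c₀ * θ) * Real.log N := by
    rw [add_assoc]
    refine (hζ _ hs0 hsδ).trans ?_
    calc 2 / ‖α + β‖ ≤ 2 / (c₀ / Real.log T) := by gcongr
      _ = _ := by rw [hlN]; field_simp
  have hmain := h N α β hL1 hN1 (hsc α hα) (hsc β hβ) x y hxy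
  rw [mainTerm, double_sum_eq, norm_mul, norm_mul, norm_mul, Complex.norm_real, Real.norm_eq_abs,
    abs_of_pos hT0]
  calc _ ≤ T * ‖FourierTransform.fourier Φ 0‖ * (2 / (c₀ * θ) * Real.log N)
        * (K / Real.log N ^ 3) := by gcongr
    _ = _ := by field_simp

theorem mainTheorem4 (P : Polynomial ℂ) (hP : P.eval 0 = 0) :
    -- the shape of the difference `c_n = a_n - b_n`
    (∀ N : ℝ, 1 < N →
      (∀ n : ℕ,
        (¬ ∃ p k m : ℕ, p.Prime ∧ 2 ≤ k ∧ Squarefree m ∧ Nat.Coprime m p ∧ n = p ^ k * m) →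
          coeffC P N n = 0) ∧
      (∀ p k m : ℕ, p.Prime → 2 ≤ k → Squarefree m → Nat.Coprime m p →
          coeffC P N (p ^ k * m) =
            ((Real.log p ^ 2 * (ArithmeticFunction.moebius m : ℝ) / Real.log N ^ 2 : ℝ) : ℂ) *
              polyWeight P N (p ^ k * m))) ∧
    -- all terms that involve `c` are negligible
    (∃ A : ℕ, ∀ (θ : ℝ), 0 < θ → θ < 1 →
      ∀ (Φ : ℝ → ℂ), MeasureTheory.Integrable Φ →
      ∀ (c₀ C₀ : ℝ), 0 < c₀ → 0 < C₀ →
      ∃ K T₀ : ℝ, ∀ T : ℝ, T₀ ≤ T → ∀ N : ℝ, N = T ^ θ →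
        ∀ α β : ℂ, ‖α‖ ≤ C₀ / Real.log T → ‖β‖ ≤ C₀ / Real.log T →
          c₀ / Real.log T ≤ ‖α + β‖ →
          ‖mainTerm Φ T N α β (coeffB P N) (coeffC P N)‖
              ≤ K * (T * Real.log (Real.log N) ^ A / Real.log N ^ 2) ∧
          ‖mainTerm Φ T N α β (coeffC P N) (coeffB P N)‖
              ≤ K * (T * Real.log (Real.log N) ^ A / Real.log N ^ 2) ∧
          ‖mainTerm Φ T N α β (coeffC P N) (coeffC P N)‖
              ≤ K * (T * Real.log (Real.log N) ^ A / Real.log N ^ 2) ∧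
          ‖mainTerm Φ T N α β (coeffA P N) (coeffA P N)
              - mainTerm Φ T N α β (coeffB P N) (coeffB P N)‖
              ≤ K * (T * Real.log (Real.log N) ^ A / Real.log N ^ 2)) := by
  -- The witness `A = 0` works because no power of `log log N` is lost.
  refine ⟨fun N _ => ⟨fun n hn => ?_, fun p k m hp hk hm hc => ?_⟩, 0, ?_⟩
  · rw [coeffC_eq, nonsquarefreePart_eq_zero hn]; simp
  · rw [coeffC_eq, nonsquarefreePart_prime_pow_mul hp hk hm hc]
  intro θ hθ hθ1 Φ _ c₀ C₀ hc₀ hC₀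
  obtain ⟨K, T₀, hK, hT₀, h⟩ := exists_norm_mainTerm_le P hP hθ hθ1 Φ hc₀ hC₀
  -- Expanding `a = b + c` leaves three terms involving `c`, hence `3K`.
  refine ⟨3 * K, T₀, ?_⟩
  rintro T hT N rfl α β hα hβ hαβ
  have h1 := h T hT α β hα hβ hαβ
  have hbc := h1 _ _ (Or.inl ⟨rfl, rfl⟩)
  have hcb := h1 _ _ (Or.inr (Or.inl ⟨rfl, rfl⟩))
  have hcc := h1 _ _ (Or.inr (Or.inr ⟨rfl, rfl⟩))
  have hT0 : 0 ≤ T := by linarith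
  have hX : 0 ≤ K * (T / Real.log (T ^ θ) ^ 2) := by positivity
  rw [pow_zero, mul_one]
  refine ⟨by linarith, by linarith, by linarith, ?_⟩
  have e : mainTerm Φ T (T ^ θ) α β (coeffA P (T ^ θ)) (coeffA P (T ^ θ))
      - mainTerm Φ T (T ^ θ) α β (coeffB P (T ^ θ)) (coeffB P (T ^ θ))
      = mainTerm Φ T (T ^ θ) α β (coeffB P (T ^ θ)) (coeffC P (T ^ θ))
        + mainTerm Φ T (T ^ θ) α β (coeffC P (T ^ θ)) (coeffB P (T ^ θ))
        + mainTerm Φ T (T ^ θ) α β (coeffC P (T ^ θ)) (coeffC P (T ^ θ)) := by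
    rw [coeffA_eq_add, mainTerm_add_left, mainTerm_add_right, mainTerm_add_right]
    ring
  rw [e]
  have := norm_add₃_le (a := mainTerm Φ T (T ^ θ) α β (coeffB P (T ^ θ)) (coeffC P (T ^ θ)))
    (b := mainTerm Φ T (T ^ θ) α β (coeffC P (T ^ θ)) (coeffB P (T ^ θ)))
    (c := mainTerm Φ T (T ^ θ) α β (coeffC P (T ^ θ)) (coeffC P (T ^ θ)))
  linarith
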